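/- Let $M$ be a smooth manifold and let $F\subset TM$ be a smooth integrable (involutive) subbundle of rank $p$ and codimension $q$. Let $g=g^{TM}$ be a smooth Riemannian metric on $M$, let $F^\perp$ be the orthogonal complement of $F$, let $p,p^\perp$ also denote the orthogonal projections of $TM$ onto $F,F^\perp$, write $g=g^F\oplus g^{F^\perp}$ and $\langle\cdot,\cdot\rangle=g$, and let $\nabla$ be the Levi-Civita connection of $g$. For $\varepsilon>0$ put $g^{\varepsilon}=g^F\oplus\frac1\varepsilon g^{F^\perp}$, with Levi-Civita connection $\nabla^{\varepsilon}$ and scalar curvature $k^{TM,\varepsilon}$. Let $R^F$ be the curvature of the connection $\nabla^F=p\nabla p$ on $F$ (along the leaves, the Levi-Civita connection of the leaves), and let $k^F=\sum_{i,j}\langle R^F(f_i,f_j)f_j,f_i\rangle$, for an orthonormal basis $(f_i)$ of $F$, be the leafwise scalar curvature, where $R(X,Y)=[\nabla_X,\nabla_Y]-\nabla_{[X,Y]}$. For a section $X$ of $F$ and sections $U,V$ of $F^\perp$ let $\dot\nabla_XU=p^\perp[X,U]$ be the Bott connection on $F^\perp$, let $\dot\nabla^{\star}$ be its dual, determined by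 $X\langle U,V\rangle=\langle\dot\nabla^{\star}_XU,V\rangle+\langle U,\dot\nabla_XV\rangle$ (with values in $F^\perp$), and put $\omega=\dot\nabla^{\star}-\dot\nabla$, $\omega(X)(U,V)=\langle\omega(X)U,V\rangle$. Let $(f_1,\dots,f_p,h_1,\dots,h_q)$ be a smooth $g$-orthonormal frame on an open set $\mathcal U\subset M$, with $f_i$ in $F$ and $h_s$ in $F^\perp$, and let $A_{is}=\frac12\sum_{t=1}^q\omega(f_i)(h_s,h_t)\,h_t$. Then at every point of $\mathcal U$ $$\lim_{\varepsilon\to0^+}p^\perp\nabla^{\varepsilon}_{h_s}f_i=A_{is}\quad(1\le i\le p,\ 1\le s\le q),\qquad \lim_{\varepsilon\to0^+}k^{TM,\varepsilon}=k^F+\Phi(\omega),$$ where $$\Phi(\omega)=\sum_{s,t=1}^q\Big[-\tfrac14\,\omega\big(p(\nabla_{h_s}h_t+\nabla_{h_t}h_s)\big)(h_s,h_t)+\tfrac12\,\omega(p\nabla_{h_t}h_t)(h_s,h_s)\Big]$$ $$+2\sum_{i=1}^p\sum_{s=1}^q\Big\{\tfrac12\,\omega(p\nabla_{f_i}f_i)(h_s,h_s)+\tfrac12\,\omega(f_i)(h_s,p^\perp[f_i,h_s])-\langle[f_i,A_{is}],h_s\rangle-\tfrac12\,\omega(f_i)(h_s,A_{is})\Big\}.$$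 -/

import Mathlib

open Bundle VectorField Filter
open scoped Manifold ContDiff Topology

namespace Foliation

noncomputable section

/-- Vector fields on `M` (no regularity built in). -/
abbrev VField (E : Type*) [NormedAddCommGroup E] [NormedSpace ℝ E]
    (M : Type*) [TopologicalSpace M] [ChartedSpace E M] :=
  (x : M) → TangentSpace 𝓘(ℝ, E) x

/-- Fields of subspaces of the tangent spaces of `M`. -/
abbrev Distrib (E : Type*) [NormedAddCommGroup E] [NormedSpace ℝ E]
    (M : Type*) [TopologicalSpace M] [ChartedSpace E M] :=
  (x : M) → Submodule ℝ (TangentSpace 𝓘(ℝ, E) x)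

/-- Inner products on the tangent spaces of `M` (no regularity in the base point built in). -/
abbrev TMetric (E : Type*) [NormedAddCommGroup E] [NormedSpace ℝ E]
    (M : Type*) [TopologicalSpace M] [ChartedSpace E M] :=
  RiemannianMetric (fun x : M ↦ TangentSpace 𝓘(ℝ, E) x)

/-- Smooth Riemannian metrics on `M`. -/
abbrev SmoothMetric (E : Type*) [NormedAddCommGroup E] [NormedSpace ℝ E]
    (M : Type*) [TopologicalSpace M] [ChartedSpace E M] [IsManifold 𝓘(ℝ, E) ∞ M] :=
  ContMDiffRiemannianMetric 𝓘(ℝ, E) ∞ E (fun x : M ↦ TangentSpace 𝓘(ℝ, E) x)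

section Basic

variable {E : Type*} [NormedAddCommGroup E] [NormedSpace ℝ E]
  {M : Type*} [TopologicalSpace M] [ChartedSpace E M]

instance tangentSpace_finiteDimensional [FiniteDimensional ℝ E] (x : M) :
    FiniteDimensional ℝ (TangentSpace 𝓘(ℝ, E) x) :=
  inferInstanceAs (FiniteDimensional ℝ E)

/-- The derivative `X(φ)` of a function along a vector field. -/
def dirDeriv (X : VField E M) (φ : M → ℝ) (x : M) : ℝ :=
  mvfderiv 𝓘(ℝ, E) φ x (X x)

/-- The function `⟨X, Y⟩`. -/
def pair (g : TMetric E M) (X Y : VField E M) (x : M) : ℝ := g.inner x (X x) (Y x)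

section Smooth

variable [IsManifold 𝓘(ℝ, E) ∞ M]

/-- `X` is a smooth vector field on `U`. -/
def SmoothOn (X : VField E M) (U : Set M) : Prop :=
  ContMDiffOn 𝓘(ℝ, E) 𝓘(ℝ, E).tangent ∞ (fun x ↦ (⟨x, X x⟩ : TangentBundle 𝓘(ℝ, E) M)) U

/-- `F` is a smooth subbundle of rank `p` of the tangent bundle. -/
def IsSubbundle (F : Distrib E M) (p : ℕ) : Prop :=
  ∀ x : M, ∃ U : Set M, IsOpen U ∧ x ∈ U ∧ ∃ s : Fin p → VField E M,
    (∀ i, SmoothOn (s i) U) ∧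
    ∀ y ∈ U, LinearIndependent ℝ (fun i ↦ s i y) ∧
      Submodule.span ℝ (Set.range fun i ↦ s i y) = F y

/-- `F` is integrable (involutive): the bracket of two local sections of `F` is a section of `F`. -/
def IsIntegrable (F : Distrib E M) : Prop :=
  ∀ (U : Set M) (X Y : VField E M), IsOpen U → SmoothOn X U → SmoothOn Y U →
    (∀ y ∈ U, X y ∈ F y) → (∀ y ∈ U, Y y ∈ F y) →
    ∀ y ∈ U, mlieBracket 𝓘(ℝ, E) X Y y ∈ F y

/-- The right-hand side of the Koszul formula. -/
def koszul (g : TMetric E M) (X Y Z : VField E M) (x : M) : ℝ :=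
  dirDeriv X (pair g Y Z) x + dirDeriv Y (pair g X Z) x - dirDeriv Z (pair g X Y) x
    + pair g (mlieBracket 𝓘(ℝ, E) X Y) Z x
    - pair g (mlieBracket 𝓘(ℝ, E) X Z) Y x
    - pair g (mlieBracket 𝓘(ℝ, E) Y Z) X x

/-- The Levi-Civita connection `∇_X Y` of `g`: its value at `x` is the unique tangent vector `w`
such that `2 ⟨w, Z⟩ = koszul X Y Z` at `x` for all vector fields `Z` smooth near `x`. -/
def nabla (g : TMetric E M) (X Y : VField E M) : VField E M := fun x ↦
  Classical.epsilon fun w : TangentSpace 𝓘(ℝ, E) x ↦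
    ∀ (U : Set M) (Z : VField E M), IsOpen U → x ∈ U → SmoothOn Z U →
      2 * g.inner x w (Z x) = koszul g X Y Z x

/-- The curvature `R(X, Y) Z = D_X D_Y Z - D_Y D_X Z - D_[X,Y] Z` of a covariant derivative `D`. -/
def curvature (D : VField E M → VField E M → VField E M) (X Y Z : VField E M) : VField E M :=
  fun x ↦ D X (D Y Z) x - D Y (D X Z) x - D (mlieBracket 𝓘(ℝ, E) X Y) Z x

end Smooth

theorem inner_self_nonneg (g : TMetric E M) (x : M) (v : TangentSpace 𝓘(ℝ, E) x) :
    0 ≤ g.inner x v v := by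
  by_cases hv : v = 0
  · simp [hv]
  · exact (g.pos x v hv).le

/-- The bilinear form `⟨P v, P w⟩` on a tangent space. -/
def pullForm (g : TMetric E M) (x : M)
    (P : TangentSpace 𝓘(ℝ, E) x →L[ℝ] TangentSpace 𝓘(ℝ, E) x) :
    TangentSpace 𝓘(ℝ, E) x →L[ℝ] TangentSpace 𝓘(ℝ, E) x →L[ℝ] ℝ :=
  ((ContinuousLinearMap.precomp ℝ P).comp (g.inner x)).comp P

theorem pullForm_apply (g : TMetric E M) (x : M)
    (P : TangentSpace 𝓘(ℝ, E) x →L[ℝ] TangentSpace 𝓘(ℝ, E) x)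
    (v w : TangentSpace 𝓘(ℝ, E) x) : pullForm g x P v w = g.inner x (P v) (P w) := rfl

theorem pullForm_continuousAt (g : TMetric E M) (x : M)
    (P : TangentSpace 𝓘(ℝ, E) x →L[ℝ] TangentSpace 𝓘(ℝ, E) x) :
    ContinuousAt (fun v ↦ pullForm g x P v v) 0 := by
  have h := g.continuousAt x
  rw [← map_zero P] at h
  exact ContinuousAt.comp (f := P) h P.continuous.continuousAt

variable [FiniteDimensional ℝ E]

/-- The orthogonal projection `p` onto `F` at the point `x`. -/
def proj (g : TMetric E M) (F : Distrib E M) (x : M) :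
    TangentSpace 𝓘(ℝ, E) x →L[ℝ] TangentSpace 𝓘(ℝ, E) x :=
  letI : RiemannianBundle (fun x : M ↦ TangentSpace 𝓘(ℝ, E) x) := ⟨g⟩
  (F x).starProjection

/-- The orthogonal projection onto the orthogonal complement of `F` at the point `x`. -/
def coproj (g : TMetric E M) (F : Distrib E M) (x : M) :
    TangentSpace 𝓘(ℝ, E) x →L[ℝ] TangentSpace 𝓘(ℝ, E) x :=
  ContinuousLinearMap.id ℝ _ - proj g F x

/-- The `F`-component of a vector field. -/
def tang (g : TMetric E M) (F : Distrib E M) (X : VField E M) : VField E M :=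
  fun x ↦ proj g F x (X x)

/-- The component of a vector field orthogonal to `F`. -/
def perp (g : TMetric E M) (F : Distrib E M) (X : VField E M) : VField E M :=
  fun x ↦ coproj g F x (X x)

theorem inner_self_split (g : TMetric E M) (F : Distrib E M) (x : M)
    (v : TangentSpace 𝓘(ℝ, E) x) :
    g.inner x v v = g.inner x (proj g F x v) (proj g F x v)
      + g.inner x (coproj g F x v) (coproj g F x v) := by
  have h : g.inner x (coproj g F x v) (proj g F x v) = 0 := by
    let _ : RiemannianBundle (fun x : M ↦ TangentSpace 𝓘(ℝ, E) x) := ⟨g⟩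
    exact (F x).starProjection_inner_eq_zero v ((F x).starProjection v)
      (Submodule.starProjection_apply_mem _ _)
  have h' := (g.symm x (proj g F x v) (coproj g F x v)).trans h
  have hv : v = proj g F x v + coproj g F x v := by simp [coproj]
  conv_lhs => rw [hv]
  simp [h, h']

/-- The inner product `⟨p v, p w⟩ + ε⁻¹ ⟨p^⊥ v, p^⊥ w⟩` on a tangent space. -/
def adiabaticForm (g : TMetric E M) (F : Distrib E M) (ε : ℝ) (x : M) :
    TangentSpace 𝓘(ℝ, E) x →L[ℝ] TangentSpace 𝓘(ℝ, E) x →L[ℝ] ℝ :=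
  pullForm g x (proj g F x) + ε⁻¹ • pullForm g x (coproj g F x)

theorem adiabaticForm_apply (g : TMetric E M) (F : Distrib E M) (ε : ℝ) (x : M)
    (v w : TangentSpace 𝓘(ℝ, E) x) :
    adiabaticForm g F ε x v w = g.inner x (proj g F x v) (proj g F x w)
      + ε⁻¹ * g.inner x (coproj g F x v) (coproj g F x w) := rfl

theorem inner_self_le_adiabatic (g : TMetric E M) (F : Distrib E M) {ε : ℝ} (hε : 0 < ε) (x : M)
    (v : TangentSpace 𝓘(ℝ, E) x) :
    g.inner x v v ≤ (1 + ε) * adiabaticForm g F ε x v v := by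
  have h1 := inner_self_nonneg g x (proj g F x v)
  have h2 := inner_self_nonneg g x (coproj g F x v)
  rw [inner_self_split g F x v, adiabaticForm_apply]
  have h3 : (1 + ε) * (ε⁻¹ * g.inner x (coproj g F x v) (coproj g F x v))
      = ε⁻¹ * g.inner x (coproj g F x v) (coproj g F x v)
        + g.inner x (coproj g F x v) (coproj g F x v) := by
    field_simp
  have h4 : 0 ≤ ε⁻¹ * g.inner x (coproj g F x v) (coproj g F x v) := by positivity
  have h5 : 0 ≤ ε * g.inner x (proj g F x v) (proj g F x v) := by positivity
  linarith [mul_add (1 + ε) (g.inner x (proj g F x v) (proj g F x v))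
    (ε⁻¹ * g.inner x (coproj g F x v) (coproj g F x v)),
    add_mul 1 ε (g.inner x (proj g F x v) (proj g F x v))]

/-- The metric `g^ε = g^F ⊕ (1/ε) g^{F^⊥}`, `ε > 0`. -/
def adiabatic (g : TMetric E M) (F : Distrib E M) (ε : Set.Ioi (0 : ℝ)) : TMetric E M where
  inner x := adiabaticForm g F ε x
  symm x v w := by
    simp only [adiabaticForm_apply]
    rw [g.symm x (proj g F x v), g.symm x (coproj g F x v)]
  pos x v hv := by
    have hε : (0 : ℝ) < ε := ε.2
    have h := (g.pos x v hv).trans_le (inner_self_le_adiabatic g F hε x v)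
    exact pos_of_mul_pos_right h (by positivity)
  continuousAt x :=
    (pullForm_continuousAt g x (proj g F x)).add
      ((pullForm_continuousAt g x (coproj g F x)).const_smul (ε : ℝ)⁻¹)
  isVonNBounded x := by
    have hε : (0 : ℝ) < ε := ε.2
    have hc : (0 : ℝ) < 1 + ε := by positivity
    have hs : √(1 + ε) * √(1 + ε) = 1 + (ε : ℝ) := Real.mul_self_sqrt hc.le
    have hp : 0 < √(1 + (ε : ℝ)) := Real.sqrt_pos.2 hc
    refine ((g.isVonNBounded x).image
      (√(1 + (ε : ℝ)) • ContinuousLinearMap.id ℝ (TangentSpace 𝓘(ℝ, E) x))).subset ?_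
    intro v hv
    have hv' : adiabaticForm g F ε x v v < 1 := hv
    have h := inner_self_le_adiabatic g F hε x v
    refine ⟨(√(1 + (ε : ℝ)))⁻¹ • v, ?_, by simp [smul_smul, hp.ne']⟩
    have h2 : g.inner x v v < 1 + ε := by nlinarith
    change g.inner x ((√(1 + (ε : ℝ)))⁻¹ • v) ((√(1 + (ε : ℝ)))⁻¹ • v) < 1
    simp only [map_smul, smul_apply, smul_eq_mul]
    rw [← mul_assoc, ← mul_inv, hs, inv_mul_lt_iff₀ hc]
    simpa using h2

variable [IsManifold 𝓘(ℝ, E) ∞ M]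

/-- The scalar curvature of `g` at `x`: the sum of `⟨R(e_a, e_b) e_b, e_a⟩` over an orthonormal
basis of the tangent space at `x`; `R` is a tensor, so it is evaluated on vector fields that are
smooth near `x` and have the prescribed values at `x`. -/
def scalarCurvature (g : TMetric E M) (x : M) : ℝ :=
  letI : RiemannianBundle (fun x : M ↦ TangentSpace 𝓘(ℝ, E) x) := ⟨g⟩
  let e := stdOrthonormalBasis ℝ (TangentSpace 𝓘(ℝ, E) x)
  let X : Fin (Module.finrank ℝ (TangentSpace 𝓘(ℝ, E) x)) → VField E M :=
    fun a ↦ FiberBundle.extend E (e a)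
  ∑ a, ∑ b, pair g (curvature (nabla g) (X a) (X b) (X b)) (X a) x

/-- The connection `∇^F = p ∇ p` on `F`, the restriction of the Levi-Civita connection to `F`.
Along the leaves of an integrable `F` it is the Levi-Civita connection of the leaves. -/
def nablaF (g : TMetric E M) (F : Distrib E M) (X Y : VField E M) : VField E M :=
  tang g F (nabla g X (tang g F Y))

/-- The leafwise scalar curvature `k^F` at `x`: the sum of `⟨R^F(e_a, e_b) e_b, e_a⟩` over an
orthonormal basis of `F` at `x`, where `R^F` is the curvature of `∇^F`; the basis vectors are
extended to local smooth sections of `F`. -/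
def leafScalarCurvature (g : TMetric E M) (F : Distrib E M) (x : M) : ℝ :=
  letI : RiemannianBundle (fun x : M ↦ TangentSpace 𝓘(ℝ, E) x) := ⟨g⟩
  let e := stdOrthonormalBasis ℝ (F x)
  let X : Fin (Module.finrank ℝ (F x)) → VField E M :=
    fun a ↦ tang g F (FiberBundle.extend E (e a : TangentSpace 𝓘(ℝ, E) x))
  ∑ a, ∑ b, pair g (curvature (nablaF g F) (X a) (X b) (X b)) (X a) x

/-- The Bott connection `p^⊥ [X, U]` on `F^⊥`, for sections `X` of `F` and `U` of `F^⊥`. -/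
def bott (g : TMetric E M) (F : Distrib E M) (X U : VField E M) : VField E M :=
  perp g F (mlieBracket 𝓘(ℝ, E) X U)

/-- The connection dual to the Bott connection: its value at `x` is the unique `w ∈ F^⊥` such that
`X⟨U, V⟩ = ⟨w, V⟩ + ⟨U, bott X V⟩` at `x` for all local smooth sections `V` of `F^⊥`. -/
def bottDual (g : TMetric E M) (F : Distrib E M) (X U : VField E M) : VField E M := fun x ↦
  Classical.epsilon fun w : TangentSpace 𝓘(ℝ, E) x ↦
    proj g F x w = 0 ∧
    ∀ (O : Set M) (V : VField E M), IsOpen O → x ∈ O → SmoothOn V O →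
      (∀ y ∈ O, proj g F y (V y) = 0) →
      dirDeriv X (pair g U V) x = g.inner x w (V x) + pair g U (bott g F X V) x

/-- `ω(X)(U, V) = ⟨ω(X) U, V⟩`, where `ω` is the dual Bott connection minus the Bott connection. -/
def omega (g : TMetric E M) (F : Distrib E M) (X U V : VField E M) : M → ℝ :=
  pair g (fun y ↦ bottDual g F X U y - bott g F X U y) V

/-- `(f, h)` is a smooth `g`-orthonormal frame on `U` with `f_i` in `F` and `h_s` in `F^⊥`. -/
structure IsAdaptedFrame (g : TMetric E M) (F : Distrib E M) (U : Set M) {p q : ℕ}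
    (f : Fin p → VField E M) (h : Fin q → VField E M) : Prop where
  smooth_f : ∀ i, SmoothOn (f i) U
  smooth_h : ∀ s, SmoothOn (h s) U
  mem_f : ∀ i, ∀ y ∈ U, f i y ∈ F y
  perp_h : ∀ s, ∀ y ∈ U, ∀ v ∈ F y, g.inner y (h s y) v = 0
  orthonormal_f : ∀ i j, ∀ y ∈ U, g.inner y (f i y) (f j y) = if i = j then 1 else 0
  orthonormal_h : ∀ s t, ∀ y ∈ U, g.inner y (h s y) (h t y) = if s = t then 1 else 0

/-- The section `A(X, U) = (1/2) ∑_t ω(X)(U, h_t) h_t` of `F^⊥`. -/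
def secA (g : TMetric E M) (F : Distrib E M) {q : ℕ} (h : Fin q → VField E M)
    (X U : VField E M) : VField E M :=
  fun y ↦ (1 / 2 : ℝ) • ∑ t, omega g F X U (h t) y • h t y

/-- The function `Φ(ω)`, computed in the adapted orthonormal frame `(f, h)`. -/
def Phi (g : TMetric E M) (F : Distrib E M) {p q : ℕ}
    (f : Fin p → VField E M) (h : Fin q → VField E M) (x : M) : ℝ :=
  (∑ s, ∑ t,
    (-(1 / 4 : ℝ) * omega g F
        (tang g F (fun y ↦ nabla g (h s) (h t) y + nabla g (h t) (h s) y)) (h s) (h t) x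
      + (1 / 2 : ℝ) * omega g F (tang g F (nabla g (h t) (h t))) (h s) (h s) x))
  + 2 * ∑ i, ∑ s,
    ((1 / 2 : ℝ) * omega g F (tang g F (nabla g (f i) (f i))) (h s) (h s) x
      + (1 / 2 : ℝ) * omega g F (f i) (h s) (perp g F (mlieBracket 𝓘(ℝ, E) (f i) (h s))) x
      - pair g (mlieBracket 𝓘(ℝ, E) (f i) (secA g F h (f i) (h s))) (h s) x
      - (1 / 2 : ℝ) * omega g F (f i) (h s) (secA g F h (f i) (h s)) x)

end Basic

end

end Foliation

/-! Everything is read off from structure functions. For an orthonormal frame `e` put `C a b c =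
⟨[e_a, e_b], e_c⟩`. The Koszul formula gives the Christoffel symbols `chr C a b c = (C a b c - C a c
b - C b c a) / 2`, so the scalar curvature is `-2 ∑ e_a(C b a b) + quad C`, where `quad C` is a
quadratic polynomial in `C` (`sum_curvature_eq_structFn`). The same formula holds for the leafwise
curvature with the frame `f` of `F`, since the bracket preserves sections of `F` and `p` disappears
when pairing with `f_k`.

The frame `(f_i, √ε h_s)` is orthonormal for `g^ε`. With scales `r = 1` on `f` and `r = √ε` on `h`,
its structure functions are `r_a r_b / r_c` times those of `(f, h)` (`structFn_adiabatic`). The only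
ones that could blow up are `⟨[f_i, f_j], h_s⟩ / √ε`, and these vanish by integrability. Those of
type `⟨[f, f], f⟩` and `⟨[f, h], h⟩` do not depend on `ε`; all the others tend to zero. In the
derivative terms, those along `h_s` carry a factor `ε`. Hence all limits exist, and they depend only
on the leafwise structure functions `A` and on `K i s t = ⟨[f_i, h_s], h_t⟩` (`limitStruct`).

On the other side, `X⟨h_s, h_t⟩ = 0` makes the dual of the Bott connection minus its transpose, so
`ω(f_i)(h_s, h_t) = -(K i s t + K i t s)` (`omega_frame`). The limiting Christoffel symbol in the
direction `h_s, f_i, h_t` is half of this, which is the first limit. For the second,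
`quad_limitStruct` and `phi_algebra` bring the limit of the curvature and `Φ(ω)` to the same
expression in `A`, `K` and the derivatives `f_i(ω(f_i)(h_s, h_s))`.

The connections are defined by a choice operator and the curvatures by arbitrary extensions of a
basis at one point. The work before this computation shows that the defining conditions have
solutions and that the traces are tensorial, so that any orthonormal frame may be used. -/

namespace Foliation

/-! ### Calculus of vector fields and functions on open sets -/

section Calculus

variable {E : Type*} [NormedAddCommGroup E] [NormedSpace ℝ E]
  {M : Type*} [TopologicalSpace M] [ChartedSpace E M]

variable (E) in
/-- `φ` is a smooth function on `U`. -/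
abbrev SmoothFnOn (φ : M → ℝ) (U : Set M) : Prop :=
  ContMDiffOn 𝓘(ℝ, E) 𝓘(ℝ, ℝ) ∞ φ U

theorem SmoothFnOn.mdifferentiableAt {φ : M → ℝ} {U : Set M} (hφ : SmoothFnOn E φ U)
    (hU : IsOpen U) {x : M} (hx : x ∈ U) : MDifferentiableAt 𝓘(ℝ, E) 𝓘(ℝ, ℝ) φ x :=
  (hφ.contMDiffAt (hU.mem_nhds hx)).mdifferentiableAt (by simp)

theorem dirDeriv_congr {X : VField E M} {φ ψ : M → ℝ} {U : Set M} (hU : IsOpen U)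
    (h : Set.EqOn φ ψ U) {x : M} (hx : x ∈ U) : dirDeriv X φ x = dirDeriv X ψ x := by
  have h' : φ =ᶠ[𝓝 x] ψ := h.eventuallyEq_of_mem (hU.mem_nhds hx)
  simp only [dirDeriv, mvfderiv]
  rw [h'.mfderiv_eq]
  rfl

theorem dirDeriv_congr_left {X Y : VField E M} {φ : M → ℝ} {x : M} (h : X x = Y x) :
    dirDeriv X φ x = dirDeriv Y φ x := by
  simp [dirDeriv, h]

theorem dirDeriv_const (X : VField E M) (c : ℝ) (x : M) : dirDeriv X (fun _ ↦ c) x = 0 := by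
  simp [dirDeriv, mvfderiv_const]

theorem dirDeriv_of_eqOn_const {X : VField E M} {φ : M → ℝ} {c : ℝ} {U : Set M} (hU : IsOpen U)
    (h : ∀ y ∈ U, φ y = c) {x : M} (hx : x ∈ U) : dirDeriv X φ x = 0 := by
  rw [dirDeriv_congr hU (ψ := fun _ ↦ c) h hx, dirDeriv_const]

theorem dirDeriv_add_left (X Y : VField E M) (φ : M → ℝ) (x : M) :
    dirDeriv (fun y ↦ X y + Y y) φ x = dirDeriv X φ x + dirDeriv Y φ x := by
  simp [dirDeriv]

theorem dirDeriv_smul_left (ψ : M → ℝ) (X : VField E M) (φ : M → ℝ) (x : M) :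
    dirDeriv (fun y ↦ ψ y • X y) φ x = ψ x * dirDeriv X φ x := by
  simp [dirDeriv]

section Functions

variable {U : Set M} (hU : IsOpen U) {x : M} (hx : x ∈ U) {X : VField E M} {φ ψ : M → ℝ}
include hU hx

theorem dirDeriv_add (hφ : SmoothFnOn E φ U) (hψ : SmoothFnOn E ψ U) :
    dirDeriv X (fun y ↦ φ y + ψ y) x = dirDeriv X φ x + dirDeriv X ψ x := by
  simp [dirDeriv, mvfderiv_fun_add (hφ.mdifferentiableAt hU hx) (hψ.mdifferentiableAt hU hx)]

theorem dirDeriv_mul (hφ : SmoothFnOn E φ U) (hψ : SmoothFnOn E ψ U) :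
    dirDeriv X (fun y ↦ φ y * ψ y) x = φ x * dirDeriv X ψ x + ψ x * dirDeriv X φ x := by
  simp [dirDeriv, mvfderiv_fun_mul (hφ.mdifferentiableAt hU hx) (hψ.mdifferentiableAt hU hx)]

theorem dirDeriv_const_mul (c : ℝ) (hφ : SmoothFnOn E φ U) :
    dirDeriv X (fun y ↦ c * φ y) x = c * dirDeriv X φ x := by
  rw [dirDeriv_mul hU hx (φ := fun _ ↦ c) contMDiffOn_const hφ, dirDeriv_const]
  simp

end Functions

variable {U : Set M}

theorem mlieBracket_congr (hU : IsOpen U) {X X' Y Y' : VField E M} (hX : ∀ y ∈ U, X y = X' y)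
    (hY : ∀ y ∈ U, Y y = Y' y) {x : M} (hx : x ∈ U) :
    mlieBracket 𝓘(ℝ, E) X Y x = mlieBracket 𝓘(ℝ, E) X' Y' x :=
  Filter.EventuallyEq.mlieBracket_vectorField_eq
    (Filter.eventually_of_mem (hU.mem_nhds hx) hX) (Filter.eventually_of_mem (hU.mem_nhds hx) hY)

theorem mlieBracket_skew (X Y : VField E M) (x : M) :
    mlieBracket 𝓘(ℝ, E) X Y x = - mlieBracket 𝓘(ℝ, E) Y X x :=
  mlieBracket_swap_apply

variable [IsManifold 𝓘(ℝ, E) ∞ M]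

theorem SmoothOn.mono {X : VField E M} {V : Set M} (hX : SmoothOn X U) (h : V ⊆ U) :
    SmoothOn X V :=
  ContMDiffOn.mono hX h

theorem SmoothOn.congr {X Y : VField E M} (hX : SmoothOn X U) (h : ∀ y ∈ U, Y y = X y) :
    SmoothOn Y U :=
  ContMDiffOn.congr hX fun y hy ↦ by rw [h y hy]

theorem SmoothOn.add {X Y : VField E M} (hX : SmoothOn X U) (hY : SmoothOn Y U) :
    SmoothOn (fun y ↦ X y + Y y) U :=
  ContMDiffOn.add_section hX hY

theorem SmoothOn.smul {φ : M → ℝ} {X : VField E M} (hφ : SmoothFnOn E φ U) (hX : SmoothOn X U) :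
    SmoothOn (fun y ↦ φ y • X y) U :=
  ContMDiffOn.smul_section hφ hX

theorem SmoothOn.sum {ι : Type*} {s : Finset ι} {X : ι → VField E M}
    (hX : ∀ i ∈ s, SmoothOn (X i) U) : SmoothOn (fun y ↦ ∑ i ∈ s, X i y) U :=
  ContMDiffOn.sum_section hX

theorem SmoothOn.mdifferentiableAt {X : VField E M} (hX : SmoothOn X U) (hU : IsOpen U) {x : M}
    (hx : x ∈ U) : MDifferentiableAt 𝓘(ℝ, E) 𝓘(ℝ, E).tangent
      (fun x ↦ (⟨x, X x⟩ : TangentBundle 𝓘(ℝ, E) M)) x :=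
  (ContMDiffOn.contMDiffAt hX (hU.mem_nhds hx)).mdifferentiableAt (by simp)

/-- The function is the fibre component of the tangent map of `φ` composed with the section `X`. -/
theorem SmoothFnOn.dirDeriv {φ : M → ℝ} {X : VField E M} (hφ : SmoothFnOn E φ U)
    (hX : SmoothOn X U) (hU : IsOpen U) : SmoothFnOn E (Foliation.dirDeriv X φ) U := by
  have h1 := hφ.contMDiffOn_tangentMapWithin (m := ∞) (by simp) hU.uniqueMDiffOn
  have h2 := ContMDiffOn.comp h1 hX (fun x hx ↦ hx)
  have h3 := (contMDiff_snd_tangentBundle_modelSpace ℝ 𝓘(ℝ, ℝ) (n := ∞)).comp_contMDiffOn h2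
  refine h3.congr fun y hy ↦ ?_
  simp only [Foliation.dirDeriv, mvfderiv, tangentMapWithin, Function.comp,
    mfderivWithin_of_isOpen hU hy]
  rfl

theorem isManifold_minSmoothness_two : IsManifold 𝓘(ℝ, E) (minSmoothness ℝ 2) M :=
  IsManifold.of_le (n := ∞) (by simpa using ENat.LEInfty.out)

theorem isManifold_minSmoothness_three : IsManifold 𝓘(ℝ, E) (minSmoothness ℝ 3) M :=
  IsManifold.of_le (n := ∞) (by simpa using ENat.LEInfty.out)

variable [FiniteDimensional ℝ E]

theorem SmoothOn.mlieBracket {X Y : VField E M} (hX : SmoothOn X U) (hY : SmoothOn Y U)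
    (hU : IsOpen U) : SmoothOn (VectorField.mlieBracket 𝓘(ℝ, E) X Y) U := by
  have := FiniteDimensional.complete ℝ E
  have := isManifold_minSmoothness_two (E := E) (M := M)
  intro x hx
  have : IsManifold 𝓘(ℝ, E) (((⊤ : ℕ∞) : ℕ∞ω) + 1) M := inferInstanceAs (IsManifold 𝓘(ℝ, E) ∞ M)
  exact (ContMDiffAt.mlieBracket_vectorField (m := ⊤) (n := ⊤)
    (ContMDiffOn.contMDiffAt hX (hU.mem_nhds hx))
    (ContMDiffOn.contMDiffAt hY (hU.mem_nhds hx)) (by simp)).contMDiffWithinAt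

section Bracket

variable (hU : IsOpen U) {x : M} (hx : x ∈ U) {X Y Z : VField E M} {φ : M → ℝ}
include hU hx

theorem mlieBracket_fun_add_right (hY : SmoothOn Y U) (hZ : SmoothOn Z U) :
    mlieBracket 𝓘(ℝ, E) X (fun y ↦ Y y + Z y) x
      = mlieBracket 𝓘(ℝ, E) X Y x + mlieBracket 𝓘(ℝ, E) X Z x := by
  have := FiniteDimensional.complete ℝ E
  exact mlieBracket_add_right (hY.mdifferentiableAt hU hx) (hZ.mdifferentiableAt hU hx)

theorem mlieBracket_fun_smul_right (hφ : SmoothFnOn E φ U) (hY : SmoothOn Y U) :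
    mlieBracket 𝓘(ℝ, E) X (fun y ↦ φ y • Y y) x
      = dirDeriv X φ x • Y x + φ x • mlieBracket 𝓘(ℝ, E) X Y x := by
  have := FiniteDimensional.complete ℝ E
  exact mlieBracket_smul_right (hφ.mdifferentiableAt hU hx) (hY.mdifferentiableAt hU hx)

theorem mlieBracket_fun_add_left (hY : SmoothOn Y U) (hZ : SmoothOn Z U) :
    mlieBracket 𝓘(ℝ, E) (fun y ↦ Y y + Z y) X x
      = mlieBracket 𝓘(ℝ, E) Y X x + mlieBracket 𝓘(ℝ, E) Z X x := by
  rw [mlieBracket_skew, mlieBracket_fun_add_right hU hx hY hZ, mlieBracket_skew X Y,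
    mlieBracket_skew X Z]
  abel

theorem mlieBracket_fun_smul_left (hφ : SmoothFnOn E φ U) (hY : SmoothOn Y U) :
    mlieBracket 𝓘(ℝ, E) (fun y ↦ φ y • Y y) X x
      = φ x • mlieBracket 𝓘(ℝ, E) Y X x - dirDeriv X φ x • Y x := by
  rw [mlieBracket_skew, mlieBracket_fun_smul_right hU hx hφ hY, mlieBracket_skew X Y]
  simp only [smul_neg, neg_add_rev, neg_neg]
  abel

theorem jacobi (hX : SmoothOn X U) (hY : SmoothOn Y U) (hZ : SmoothOn Z U) :
    mlieBracket 𝓘(ℝ, E) X (mlieBracket 𝓘(ℝ, E) Y Z) x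
      = mlieBracket 𝓘(ℝ, E) (mlieBracket 𝓘(ℝ, E) X Y) Z x
        + mlieBracket 𝓘(ℝ, E) Y (mlieBracket 𝓘(ℝ, E) X Z) x := by
  have := FiniteDimensional.complete ℝ E
  have := isManifold_minSmoothness_three (E := E) (M := M)
  have hs : ∀ {W : VField E M}, SmoothOn W U →
      ContMDiffAt 𝓘(ℝ, E) 𝓘(ℝ, E).tangent (minSmoothness ℝ 2)
        (fun x ↦ (⟨x, W x⟩ : TangentBundle 𝓘(ℝ, E) M)) x := fun hW ↦
    (ContMDiffOn.contMDiffAt hW (hU.mem_nhds hx)).of_le (by simpa using ENat.LEInfty.out)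
  exact leibniz_identity_mlieBracket_apply (hs hX) (hs hY) (hs hZ)

/-- The Lie bracket acts on functions as the commutator of derivations. -/
theorem dirDeriv_mlieBracket (hX : SmoothOn X U) (hY : SmoothOn Y U) (hφ : SmoothFnOn E φ U) :
    dirDeriv (mlieBracket 𝓘(ℝ, E) X Y) φ x
      = dirDeriv X (dirDeriv Y φ) x - dirDeriv Y (dirDeriv X φ) x := by
  -- The identity is the coefficient of `Z` in the Jacobi identity for `X`, `Y`, `φ Z`, for a field
  -- `Z` with `Z x ≠ 0`. Such a field exists unless the tangent space is zero, where both sides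
  -- vanish.
  by_cases h0 : ∀ v : TangentSpace 𝓘(ℝ, E) x, v = 0
  · simp [dirDeriv, h0 (X x), h0 (Y x), h0 (mlieBracket 𝓘(ℝ, E) X Y x)]
  push Not at h0
  obtain ⟨v, hv⟩ := h0
  obtain ⟨s, hs, hsm⟩ := FiberBundle.exists_contMDiffOn_extend (k := ∞) 𝓘(ℝ, E) E v
  obtain ⟨O, hOs, hO, hxO⟩ := mem_nhds_iff.1 hs
  set Z : VField E M := FiberBundle.extend E v with hZdef
  have hZx : Z x = v := FiberBundle.extend_apply_self E v
  set W := U ∩ O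
  have hW : IsOpen W := hU.inter hO
  have hxW : x ∈ W := ⟨hx, hxO⟩
  have hZ : SmoothOn Z W := ContMDiffOn.mono hsm (Set.inter_subset_right.trans hOs)
  have hX := hX.mono (V := W) Set.inter_subset_left
  have hY := hY.mono (V := W) Set.inter_subset_left
  have hφ : SmoothFnOn E φ W := hφ.mono Set.inter_subset_left
  have key := jacobi hW hxW hX hY (SmoothOn.smul hφ hZ)
  have hb : ∀ {A : VField E M}, SmoothOn A W → ∀ y ∈ W,
      mlieBracket 𝓘(ℝ, E) A (fun y ↦ φ y • Z y) y
        = dirDeriv A φ y • Z y + φ y • mlieBracket 𝓘(ℝ, E) A Z y :=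
    fun _ y hy ↦ mlieBracket_fun_smul_right hW hy hφ hZ
  have hbb : ∀ {A B : VField E M}, SmoothOn A W → SmoothOn B W →
      mlieBracket 𝓘(ℝ, E) A (mlieBracket 𝓘(ℝ, E) B (fun y ↦ φ y • Z y)) x
        = dirDeriv A (dirDeriv B φ) x • Z x + dirDeriv B φ x • mlieBracket 𝓘(ℝ, E) A Z x
          + (dirDeriv A φ x • mlieBracket 𝓘(ℝ, E) B Z x
            + φ x • mlieBracket 𝓘(ℝ, E) A (mlieBracket 𝓘(ℝ, E) B Z) x) := by
    intro A B hA hB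
    rw [mlieBracket_congr hW (fun _ _ ↦ rfl) (hb hB) hxW,
      mlieBracket_fun_add_right hW hxW (.smul (hφ.dirDeriv hB hW) hZ)
        (.smul hφ (hB.mlieBracket hZ hW)),
      mlieBracket_fun_smul_right hW hxW (hφ.dirDeriv hB hW) hZ,
      mlieBracket_fun_smul_right hW hxW hφ (hB.mlieBracket hZ hW)]
  rw [hbb hX hY, hbb hY hX, hb (hX.mlieBracket hY hW) x hxW, jacobi hW hxW hX hY hZ] at key
  have h2 : (dirDeriv (mlieBracket 𝓘(ℝ, E) X Y) φ x
      - (dirDeriv X (dirDeriv Y φ) x - dirDeriv Y (dirDeriv X φ) x)) • Z x = 0 := by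
    rw [← sub_eq_zero] at key
    rw [← neg_eq_zero, ← key]
    module
  rw [hZx] at h2
  rcases smul_eq_zero.1 h2 with h3 | h3
  · linarith
  · exact absurd h3 hv

end Bracket

end Calculus

/-! ### Tensoriality, orthonormal frames and connections on distributions -/

section Connections

variable {E : Type*} [NormedAddCommGroup E] [NormedSpace ℝ E]
  {M : Type*} [TopologicalSpace M] [ChartedSpace E M]

section Pair

variable (G : TMetric E M)

theorem pair_symm (X Y : VField E M) : pair G X Y = pair G Y X := by
  ext y; exact G.symm y _ _

theorem pair_add_left (X Y Z : VField E M) :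
    pair G (fun y ↦ X y + Y y) Z = fun y ↦ pair G X Z y + pair G Y Z y := by
  ext y; simp [pair]

theorem pair_add_right (X Y Z : VField E M) :
    pair G Z (fun y ↦ X y + Y y) = fun y ↦ pair G Z X y + pair G Z Y y := by
  ext y; simp [pair]

theorem pair_smul_left (φ : M → ℝ) (X Y : VField E M) :
    pair G (fun y ↦ φ y • X y) Y = fun y ↦ φ y * pair G X Y y := by
  ext y; simp [pair]

theorem pair_smul_right (φ : M → ℝ) (X Y : VField E M) :
    pair G X (fun y ↦ φ y • Y y) = fun y ↦ φ y * pair G X Y y := by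
  ext y; simp [pair]

end Pair

variable [IsManifold 𝓘(ℝ, E) ∞ M]

/-- `X` is a smooth section of the distribution `W` on `U`. -/
structure IsSec (W : Distrib E M) (U : Set M) (X : VField E M) : Prop where
  smooth : SmoothOn X U
  mem : ∀ y ∈ U, X y ∈ W y

namespace IsSec

variable {W : Distrib E M} {U : Set M} {X Y : VField E M}

theorem mono {V : Set M} (hX : IsSec W U X) (h : V ⊆ U) : IsSec W V X :=
  ⟨hX.smooth.mono h, fun y hy ↦ hX.mem y (h hy)⟩

theorem add (hX : IsSec W U X) (hY : IsSec W U Y) : IsSec W U (fun y ↦ X y + Y y) :=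
  ⟨hX.smooth.add hY.smooth, fun y hy ↦ (W y).add_mem (hX.mem y hy) (hY.mem y hy)⟩

theorem smul {φ : M → ℝ} (hφ : SmoothFnOn E φ U) (hX : IsSec W U X) :
    IsSec W U (fun y ↦ φ y • X y) :=
  ⟨.smul hφ hX.smooth, fun y hy ↦ (W y).smul_mem _ (hX.mem y hy)⟩

theorem sum {ι : Type*} {s : Finset ι} {X : ι → VField E M} (hX : ∀ i ∈ s, IsSec W U (X i)) :
    IsSec W U (fun y ↦ ∑ i ∈ s, X i y) :=
  ⟨.sum fun i hi ↦ (hX i hi).smooth, fun y hy ↦ (W y).sum_mem fun i hi ↦ (hX i hi).mem y hy⟩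

theorem top (hX : SmoothOn X U) : IsSec (fun _ ↦ ⊤) U X := ⟨hX, fun _ _ ↦ Submodule.mem_top⟩

end IsSec

/-- `T` is tensorial at `x` on the smooth sections of `W` on `U`. -/
structure IsTensorialAt {A : Type*} [AddCommGroup A] [Module ℝ A] (W : Distrib E M) (U : Set M)
    (x : M) (T : VField E M → A) : Prop where
  congr : ∀ X Y, IsSec W U X → IsSec W U Y → (∀ y ∈ U, X y = Y y) → T X = T Y
  add : ∀ X Y, IsSec W U X → IsSec W U Y → T (fun y ↦ X y + Y y) = T X + T Y
  smul : ∀ (φ : M → ℝ) X, SmoothFnOn E φ U → IsSec W U X → T (fun y ↦ φ y • X y) = φ x • T X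

namespace IsTensorialAt

variable {A : Type*} [AddCommGroup A] [Module ℝ A] {W : Distrib E M} {U : Set M} {x : M}
  {T : VField E M → A}

theorem sum_smul (hT : IsTensorialAt W U x T) {ι : Type*} (s : Finset ι) {φ : ι → M → ℝ}
    {X : ι → VField E M} (hφ : ∀ i, SmoothFnOn E (φ i) U) (hX : ∀ i, IsSec W U (X i)) :
    T (fun y ↦ ∑ i ∈ s, φ i y • X i y) = ∑ i ∈ s, φ i x • T (X i) := by
  classical
  induction s using Finset.induction_on with
  | empty =>
    -- `T 0 = 0` comes from homogeneity with the constant function `0`.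
    have h0 : IsSec W U (fun y ↦ ∑ i ∈ (∅ : Finset ι), φ i y • X i y) :=
      .sum fun i _ ↦ .smul (hφ i) (hX i)
    have := hT.smul (fun _ ↦ 0) _ contMDiffOn_const h0
    simpa using this
  | insert a s ha ih =>
    simp only [Finset.sum_insert ha]
    rw [hT.add _ _ (.smul (hφ a) (hX a)) (.sum fun i _ ↦ .smul (hφ i) (hX i)),
      hT.smul _ _ (hφ a) (hX a), ih]

theorem sum {ι : Type*} {s : Finset ι} {T : ι → VField E M → A}
    (hT : ∀ i ∈ s, IsTensorialAt W U x (T i)) : IsTensorialAt W U x (fun X ↦ ∑ i ∈ s, T i X) where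
  congr X Y hX hY h := Finset.sum_congr rfl fun i hi ↦ (hT i hi).congr X Y hX hY h
  add X Y hX hY := by
    rw [← Finset.sum_add_distrib]
    exact Finset.sum_congr rfl fun i hi ↦ (hT i hi).add X Y hX hY
  smul φ X hφ hX := by
    rw [Finset.smul_sum]
    exact Finset.sum_congr rfl fun i hi ↦ (hT i hi).smul φ X hφ hX

end IsTensorialAt

/-- `e` is a smooth `G`-orthonormal frame of the distribution `W` on the open set `U`, near which
`G` is smooth. -/
structure IsOrthoFrame (G : TMetric E M) (W : Distrib E M) (U : Set M) {ι : Type*} [Fintype ι]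
    [DecidableEq ι] (e : ι → VField E M) : Prop where
  isOpen : IsOpen U
  smooth_pair : ∀ O ⊆ U, IsOpen O → ∀ X Y, SmoothOn X O → SmoothOn Y O →
    SmoothFnOn E (pair G X Y) O
  sec : ∀ a, IsSec W U (e a)
  orthonormal : ∀ a b, ∀ y ∈ U, pair G (e a) (e b) y = if a = b then 1 else 0
  expand : ∀ y ∈ U, ∀ v ∈ W y, v = ∑ a, G.inner y v (e a y) • e a y

namespace IsOrthoFrame

variable {G : TMetric E M} {W : Distrib E M} {U : Set M} {ι : Type*} [Fintype ι] [DecidableEq ι]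
  {e : ι → VField E M}

theorem mono (he : IsOrthoFrame G W U e) {O : Set M} (h : O ⊆ U) (hO : IsOpen O) :
    IsOrthoFrame G W O e where
  isOpen := hO
  smooth_pair O' h' := he.smooth_pair O' (h'.trans h)
  sec a := (he.sec a).mono h
  orthonormal a b y hy := he.orthonormal a b y (h hy)
  expand y hy := he.expand y (h hy)

theorem smoothFnOn_pair (he : IsOrthoFrame G W U e) {X Y : VField E M} (hX : SmoothOn X U)
    (hY : SmoothOn Y U) : SmoothFnOn E (pair G X Y) U :=
  he.smooth_pair U subset_rfl he.isOpen X Y hX hY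

theorem expand_sec (he : IsOrthoFrame G W U e) {X : VField E M} (hX : IsSec W U X) :
    ∀ y ∈ U, X y = ∑ a, pair G X (e a) y • e a y :=
  fun y hy ↦ he.expand y hy (X y) (hX.mem y hy)

theorem dirDeriv_pair (he : IsOrthoFrame G W U e) {X : VField E M} (a b : ι) {x : M} (hx : x ∈ U) :
    dirDeriv X (pair G (e a) (e b)) x = 0 :=
  dirDeriv_of_eqOn_const he.isOpen (he.orthonormal a b) hx

theorem tensorial_expand (he : IsOrthoFrame G W U e) {A : Type*} [AddCommGroup A] [Module ℝ A]
    {x : M} {T : VField E M → A} (hT : IsTensorialAt W U x T) {X : VField E M}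
    (hX : IsSec W U X) : T X = ∑ a, pair G X (e a) x • T (e a) := by
  have hφ : ∀ a, SmoothFnOn E (pair G X (e a)) U := fun a ↦
    he.smoothFnOn_pair hX.smooth (he.sec a).smooth
  rw [← hT.sum_smul Finset.univ hφ he.sec]
  exact hT.congr _ _ hX (.sum fun a _ ↦ .smul (hφ a) (he.sec a)) (he.expand_sec hX)

/-- The trace of a bitensorial expression can be computed with any family of sections which is
orthonormal at the given point. -/
theorem trace_eq (he : IsOrthoFrame G W U e) {x : M} (hx : x ∈ U)
    {B : VField E M → VField E M → ℝ} (hB₁ : ∀ Y, IsSec W U Y → IsTensorialAt W U x (fun X ↦ B X Y))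
    (hB₂ : ∀ X, IsSec W U X → IsTensorialAt W U x (B X))
    {κ : Type*} [Fintype κ] [DecidableEq κ] (hκ : Fintype.card κ = Fintype.card ι)
    {e' : κ → VField E M} (he' : ∀ k, IsSec W U (e' k))
    (horth : ∀ k l, pair G (e' k) (e' l) x = if k = l then 1 else 0) :
    ∑ k, B (e' k) (e' k) = ∑ a, B (e a) (e a) := by
  let P : Matrix κ ι ℝ := fun k a ↦ pair G (e' k) (e a) x
  have h1 : P * P.transpose = 1 := by
    ext k l
    rw [Matrix.mul_apply, Matrix.one_apply, ← horth k l]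
    have := he.expand_sec (he' k) x hx
    conv_rhs => rw [pair, this]
    simp only [map_sum, map_smul, FunLike.coe_sum, Finset.sum_apply, FunLike.coe_smul,
      Pi.smul_apply, smul_eq_mul, Matrix.transpose_apply]
    refine Finset.sum_congr rfl fun a _ ↦ ?_
    rw [G.symm x (e a x)]
    rfl
  -- The two families have the same cardinality, so a one-sided inverse of the transition matrix is
  -- two-sided. Orthonormality of the rows thus becomes that of the columns, which is what the
  -- change of trace uses.
  have h2 : P.transpose * P = 1 := (Matrix.mul_eq_one_comm_of_card_eq _ _ _ hκ).1 h1
  have h3 : ∀ k, B (e' k) (e' k) = ∑ a, ∑ b, (P k a * P k b) * B (e a) (e b) := by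
    intro k
    rw [he.tensorial_expand (hB₁ _ (he' k)) (he' k)]
    refine Finset.sum_congr rfl fun a _ ↦ ?_
    rw [he.tensorial_expand (hB₂ _ (he.sec a)) (he' k), Finset.smul_sum]
    refine Finset.sum_congr rfl fun b _ ↦ ?_
    simp only [smul_eq_mul, P]
    ring
  simp only [h3]
  rw [Finset.sum_comm]
  refine Finset.sum_congr rfl fun a _ ↦ ?_
  rw [Finset.sum_comm]
  have h4 : ∀ b, ∑ k, P k a * P k b * B (e a) (e b) = if a = b then B (e a) (e b) else 0 := by
    intro b
    rw [← Finset.sum_mul]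
    have := congrFun (congrFun h2 a) b
    rw [Matrix.mul_apply, Matrix.one_apply] at this
    simp only [Matrix.transpose_apply] at this
    rw [this]
    split_ifs <;> simp
  simp [h4]

end IsOrthoFrame

/-- `D` is a connection on the involutive distribution `W` along `W`, on the open set `U`. -/
structure IsConn (W : Distrib E M) (U : Set M) (D : VField E M → VField E M → VField E M) :
    Prop where
  isOpen : IsOpen U
  sec : ∀ X Y, IsSec W U X → IsSec W U Y → IsSec W U (D X Y)
  bracket : ∀ X Y, IsSec W U X → IsSec W U Y → IsSec W U (mlieBracket 𝓘(ℝ, E) X Y)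
  congr : ∀ X X' Y Y', (∀ y ∈ U, X y = X' y) → (∀ y ∈ U, Y y = Y' y) →
    ∀ x ∈ U, D X Y x = D X' Y' x
  add_left : ∀ X X' Y, IsSec W U X → IsSec W U X' → IsSec W U Y → ∀ x ∈ U,
    D (fun y ↦ X y + X' y) Y x = D X Y x + D X' Y x
  smul_left : ∀ (φ : M → ℝ) X Y, SmoothFnOn E φ U → IsSec W U X → IsSec W U Y → ∀ x ∈ U,
    D (fun y ↦ φ y • X y) Y x = φ x • D X Y x
  add_right : ∀ X Y Y', IsSec W U X → IsSec W U Y → IsSec W U Y' → ∀ x ∈ U,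
    D X (fun y ↦ Y y + Y' y) x = D X Y x + D X Y' x
  leibniz : ∀ (φ : M → ℝ) X Y, SmoothFnOn E φ U → IsSec W U X → IsSec W U Y → ∀ x ∈ U,
    D X (fun y ↦ φ y • Y y) x = dirDeriv X φ x • Y x + φ x • D X Y x

namespace IsConn

variable {W : Distrib E M} {U : Set M} {D : VField E M → VField E M → VField E M}

theorem tensorial_left (hD : IsConn W U D) {Y : VField E M} (hY : IsSec W U Y) {x : M}
    (hx : x ∈ U) : IsTensorialAt W U x (fun X ↦ D X Y x) where
  congr X X' _ _ h := hD.congr X X' Y Y h (fun _ _ ↦ rfl) x hx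
  add X X' hX hX' := hD.add_left X X' Y hX hX' hY x hx
  smul φ X hφ hX := hD.smul_left φ X Y hφ hX hY x hx

theorem curvature_swap (hD : IsConn W U D) {X Y Z : VField E M} (hX : IsSec W U X)
    (hY : IsSec W U Y) (hZ : IsSec W U Z) {x : M} (hx : x ∈ U) :
    curvature D X Y Z x = - curvature D Y X Z x := by
  have h1 := hD.smul_left (fun _ ↦ -1) _ Z contMDiffOn_const (hD.bracket Y X hY hX) hZ x hx
  have h2 := hD.congr (mlieBracket 𝓘(ℝ, E) X Y)
    (fun y ↦ (-1 : ℝ) • mlieBracket 𝓘(ℝ, E) Y X y) Z Z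
    (fun y _ ↦ by rw [mlieBracket_skew]; simp) (fun _ _ ↦ rfl) x hx
  simp only [curvature]
  rw [h2, h1]
  module

variable [FiniteDimensional ℝ E]

/-- The term `Y(φ) D_X Z` produced by `D_Y (φ D_X Z)` cancels the one produced by `[φX, Y] = φ[X, Y]
- Y(φ) X`. -/
theorem curvature_tensorial_left (hD : IsConn W U D) {Y Z : VField E M} (hY : IsSec W U Y)
    (hZ : IsSec W U Z) {x : M} (hx : x ∈ U) :
    IsTensorialAt W U x (fun X ↦ curvature D X Y Z x) where
  congr X X' _ _ h := by
    simp only [curvature]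
    rw [hD.congr X X' (D Y Z) (D Y Z) h (fun _ _ ↦ rfl) x hx,
      hD.congr Y Y (D X Z) (D X' Z) (fun _ _ ↦ rfl)
        (hD.congr X X' Z Z h (fun _ _ ↦ rfl)) x hx,
      hD.congr (mlieBracket 𝓘(ℝ, E) X Y) (mlieBracket 𝓘(ℝ, E) X' Y) Z Z
        (fun y hy ↦ mlieBracket_congr hD.isOpen h (fun _ _ ↦ rfl) hy) (fun _ _ ↦ rfl) x hx]
  add X X' hX hX' := by
    simp only [curvature]
    rw [hD.add_left X X' (D Y Z) hX hX' (hD.sec Y Z hY hZ) x hx,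
      hD.congr Y Y _ _ (fun _ _ ↦ rfl) (hD.add_left X X' Z hX hX' hZ) x hx,
      hD.add_right Y _ _ hY (hD.sec X Z hX hZ) (hD.sec X' Z hX' hZ) x hx,
      hD.congr _ _ Z Z (fun y hy ↦ mlieBracket_fun_add_left hD.isOpen hy hX.smooth hX'.smooth)
        (fun _ _ ↦ rfl) x hx,
      hD.add_left _ _ Z (hD.bracket X Y hX hY) (hD.bracket X' Y hX' hY) hZ x hx]
    abel
  smul φ X hφ hX := by
    have hφ' := hφ.dirDeriv hY.smooth hD.isOpen
    have hb : ∀ y ∈ U, mlieBracket 𝓘(ℝ, E) (fun y ↦ φ y • X y) Y y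
        = φ y • mlieBracket 𝓘(ℝ, E) X Y y + (-1 * dirDeriv Y φ y) • X y := fun y hy ↦ by
      rw [mlieBracket_fun_smul_left hD.isOpen hy hφ hX.smooth]
      module
    have hφ'' : SmoothFnOn E (fun y ↦ -1 * dirDeriv Y φ y) U :=
      ContMDiffOn.mul contMDiffOn_const hφ'
    simp only [curvature]
    rw [hD.smul_left φ X (D Y Z) hφ hX (hD.sec Y Z hY hZ) x hx,
      hD.congr Y Y _ _ (fun _ _ ↦ rfl) (hD.smul_left φ X Z hφ hX hZ) x hx,
      hD.leibniz φ Y _ hφ hY (hD.sec X Z hX hZ) x hx,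
      hD.congr _ _ Z Z hb (fun _ _ ↦ rfl) x hx,
      hD.add_left _ _ Z (.smul hφ (hD.bracket X Y hX hY)) (.smul hφ'' hX) hZ x hx,
      hD.smul_left φ _ Z hφ (hD.bracket X Y hX hY) hZ x hx,
      hD.smul_left _ X Z hφ'' hX hZ x hx]
    module

theorem curvature_tensorial_middle (hD : IsConn W U D) {X Z : VField E M} (hX : IsSec W U X)
    (hZ : IsSec W U Z) {x : M} (hx : x ∈ U) :
    IsTensorialAt W U x (fun Y ↦ curvature D X Y Z x) where
  congr Y Y' hY hY' h := by
    rw [hD.curvature_swap hX hY hZ hx, hD.curvature_swap hX hY' hZ hx,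
      (hD.curvature_tensorial_left hX hZ hx).congr Y Y' hY hY' h]
  add Y Y' hY hY' := by
    rw [hD.curvature_swap hX (hY.add hY') hZ hx, hD.curvature_swap hX hY hZ hx,
      hD.curvature_swap hX hY' hZ hx, (hD.curvature_tensorial_left hX hZ hx).add Y Y' hY hY']
    abel
  smul φ Y hφ hY := by
    rw [hD.curvature_swap hX (.smul hφ hY) hZ hx, hD.curvature_swap hX hY hZ hx,
      (hD.curvature_tensorial_left hX hZ hx).smul φ Y hφ hY]
    module

/-- The first-order terms in `φ` are symmetric in `X, Y` and drop out. The second-order terms are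
`XYφ - YXφ - [X, Y]φ`, which is zero by `dirDeriv_mlieBracket`. -/
theorem curvature_tensorial_right (hD : IsConn W U D) {X Y : VField E M} (hX : IsSec W U X)
    (hY : IsSec W U Y) {x : M} (hx : x ∈ U) :
    IsTensorialAt W U x (fun Z ↦ curvature D X Y Z x) where
  congr Z Z' _ _ h := by
    simp only [curvature]
    rw [hD.congr X X _ _ (fun _ _ ↦ rfl) (hD.congr Y Y Z Z' (fun _ _ ↦ rfl) h) x hx,
      hD.congr Y Y _ _ (fun _ _ ↦ rfl) (hD.congr X X Z Z' (fun _ _ ↦ rfl) h) x hx,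
      hD.congr _ _ Z Z' (fun _ _ ↦ rfl) h x hx]
  add Z Z' hZ hZ' := by
    simp only [curvature]
    rw [hD.congr X X _ _ (fun _ _ ↦ rfl) (hD.add_right Y Z Z' hY hZ hZ') x hx,
      hD.add_right X _ _ hX (hD.sec Y Z hY hZ) (hD.sec Y Z' hY hZ') x hx,
      hD.congr Y Y _ _ (fun _ _ ↦ rfl) (hD.add_right X Z Z' hX hZ hZ') x hx,
      hD.add_right Y _ _ hY (hD.sec X Z hX hZ) (hD.sec X Z' hX hZ') x hx,
      hD.add_right _ Z Z' (hD.bracket X Y hX hY) hZ hZ' x hx]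
    abel
  smul φ Z hφ hZ := by
    have h2 : ∀ {A B : VField E M}, IsSec W U A → IsSec W U B →
        D A (D B (fun y ↦ φ y • Z y)) x = dirDeriv A (dirDeriv B φ) x • Z x
          + dirDeriv B φ x • D A Z x + (dirDeriv A φ x • D B Z x + φ x • D A (D B Z) x) := by
      intro A B hA hB
      have hφB := hφ.dirDeriv hB.smooth hD.isOpen
      rw [hD.congr A A _ _ (fun _ _ ↦ rfl) (hD.leibniz φ B Z hφ hB hZ) x hx,
        hD.add_right A _ _ hA (.smul hφB hZ) (.smul hφ (hD.sec B Z hB hZ)) x hx,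
        hD.leibniz _ A Z hφB hA hZ x hx, hD.leibniz φ A _ hφ hA (hD.sec B Z hB hZ) x hx]
    simp only [curvature]
    rw [h2 hX hY, h2 hY hX, hD.leibniz φ _ Z hφ (hD.bracket X Y hX hY) hZ x hx,
      dirDeriv_mlieBracket hD.isOpen hx hX.smooth hY.smooth hφ]
    module

end IsConn

theorem IsTensorialAt.inner_left {W : Distrib E M} {U : Set M} {x : M}
    {T : VField E M → TangentSpace 𝓘(ℝ, E) x} (hT : IsTensorialAt W U x T) (G : TMetric E M)
    (v : TangentSpace 𝓘(ℝ, E) x) : IsTensorialAt W U x (fun X ↦ G.inner x (T X) v) where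
  congr X Y hX hY h := by rw [hT.congr X Y hX hY h]
  add X Y hX hY := by simp [hT.add X Y hX hY]
  smul φ X hφ hX := by simp [hT.smul φ X hφ hX]

theorem isTensorialAt_inner {W : Distrib E M} {U : Set M} {x : M} (hx : x ∈ U) (G : TMetric E M)
    (v : TangentSpace 𝓘(ℝ, E) x) : IsTensorialAt W U x (fun X ↦ G.inner x v (X x)) where
  congr X Y _ _ h := by rw [h x hx]
  add X Y _ _ := by simp
  smul φ X _ _ := by simp

namespace IsOrthoFrame

variable {G : TMetric E M} {W : Distrib E M} {U : Set M} {ι : Type*} [Fintype ι] [DecidableEq ι]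
  {e : ι → VField E M} {D : VField E M → VField E M → VField E M}

/-- The covariant derivative in terms of frame coefficients. -/
theorem conn_expand (he : IsOrthoFrame G W U e) (hD : IsConn W U D) {X Y : VField E M}
    (hX : IsSec W U X) (hY : IsSec W U Y) {x : M} (hx : x ∈ U) :
    D X Y x = ∑ c, (dirDeriv X (pair G Y (e c)) x • e c x + pair G Y (e c) x • D X (e c) x) := by
  have hp : ∀ {Z : VField E M}, IsSec W U Z → ∀ c, SmoothFnOn E (pair G Z (e c)) U :=
    fun hZ c ↦ he.smoothFnOn_pair hZ.smooth (he.sec c).smooth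
  -- Subtracting the connection for which the frame is parallel leaves a tensor in `Y`. It equals
  -- `D_X e_c` on the frame, because the functions `⟨e_c, e_b⟩` are constant.
  have hT : IsTensorialAt W U x
      (fun Y ↦ D X Y x - ∑ c, dirDeriv X (pair G Y (e c)) x • e c x) := by
    refine ⟨fun Y Y' hY hY' h ↦ ?_, fun Y Y' hY hY' ↦ ?_, fun φ Y hφ hY ↦ ?_⟩
    · rw [hD.congr X X Y Y' (fun _ _ ↦ rfl) h x hx]
      congr 1
      refine Finset.sum_congr rfl fun c _ ↦ ?_
      rw [dirDeriv_congr he.isOpen (ψ := pair G Y' (e c))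
        (fun y hy ↦ by simp only [pair]; rw [h y hy]) hx]
    · rw [hD.add_right X Y Y' hX hY hY' x hx]
      have : ∀ c, dirDeriv X (pair G (fun y ↦ Y y + Y' y) (e c)) x
          = dirDeriv X (pair G Y (e c)) x + dirDeriv X (pair G Y' (e c)) x := fun c ↦ by
        rw [pair_add_left, dirDeriv_add he.isOpen hx (hp hY c) (hp hY' c)]
      simp only [this, add_smul, Finset.sum_add_distrib]
      abel
    · rw [hD.leibniz φ X Y hφ hX hY x hx]
      have : ∀ c, dirDeriv X (pair G (fun y ↦ φ y • Y y) (e c)) x • e c x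
          = φ x • (dirDeriv X (pair G Y (e c)) x • e c x)
            + dirDeriv X φ x • (pair G Y (e c) x • e c x) := fun c ↦ by
        rw [pair_smul_left, dirDeriv_mul he.isOpen hx hφ (hp hY c)]
        module
      simp only [this, Finset.sum_add_distrib, ← Finset.smul_sum]
      rw [← he.expand_sec hY x hx]
      module
  have h := he.tensorial_expand hT hY
  simp only [he.dirDeriv_pair _ _ hx, zero_smul, Finset.sum_const_zero, sub_zero] at h
  rw [Finset.sum_add_distrib, ← h]
  abel

/-- The curvature in terms of the Christoffel symbols and the structure functions of a frame. -/
theorem curvature_frame (he : IsOrthoFrame G W U e) (hD : IsConn W U D) {x : M} (hx : x ∈ U)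
    (a b : ι) :
    pair G (curvature D (e a) (e b) (e b)) (e a) x
      = dirDeriv (e a) (pair G (D (e b) (e b)) (e a)) x
        - dirDeriv (e b) (pair G (D (e a) (e b)) (e a)) x
        + ∑ c, (pair G (D (e b) (e b)) (e c) x * pair G (D (e a) (e c)) (e a) x
          - pair G (D (e a) (e b)) (e c) x * pair G (D (e b) (e c)) (e a) x
          - pair G (mlieBracket 𝓘(ℝ, E) (e a) (e b)) (e c) x
            * pair G (D (e c) (e b)) (e a) x) := by
  have hDD : ∀ {X Y : VField E M}, IsSec W U X → IsSec W U Y →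
      G.inner x (D X Y x) (e a x) = dirDeriv X (pair G Y (e a)) x
        + ∑ c, pair G Y (e c) x * pair G (D X (e c)) (e a) x := by
    intro X Y hX hY
    rw [he.conn_expand hD hX hY hx, Finset.sum_add_distrib]
    have ho : ∀ c, G.inner x (e c x) (e a x) = if c = a then 1 else 0 :=
      fun c ↦ he.orthonormal c a x hx
    simp [ho, pair]
  have hb := he.tensorial_expand
    ((hD.tensorial_left (he.sec b) hx).inner_left G (e a x)) (hD.bracket _ _ (he.sec a) (he.sec b))
  simp only [smul_eq_mul] at hb
  simp only [Finset.sum_sub_distrib]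
  change G.inner x (_ - _ - _) (e a x) = _
  simp only [map_sub, FunLike.coe_sub, Pi.sub_apply]
  rw [hDD (he.sec a) (hD.sec _ _ (he.sec b) (he.sec b)),
    hDD (he.sec b) (hD.sec _ _ (he.sec a) (he.sec b)), hb]
  simp only [pair]
  ring

variable [FiniteDimensional ℝ E]

/-- The double trace of the curvature is independent of the orthonormal family. -/
theorem sum_curvature_eq (he : IsOrthoFrame G W U e) (hD : IsConn W U D) {x : M} (hx : x ∈ U)
    {κ : Type*} [Fintype κ] [DecidableEq κ] (hκ : Fintype.card κ = Fintype.card ι)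
    {e' : κ → VField E M} (he' : ∀ k, IsSec W U (e' k))
    (horth : ∀ k l, pair G (e' k) (e' l) x = if k = l then 1 else 0) :
    ∑ k, ∑ l, pair G (curvature D (e' k) (e' l) (e' l)) (e' k) x
      = ∑ a, ∑ b, pair G (curvature D (e a) (e b) (e b)) (e a) x := by
  -- The family is exchanged one contraction at a time: first the slots of index `k` with `e'` kept
  -- in the middle, then the two middle slots.
  rw [he.trace_eq hx (B := fun X V ↦ ∑ l, pair G (curvature D X (e' l) (e' l)) V x)
    (fun V _ ↦ .sum fun l _ ↦ (hD.curvature_tensorial_left (he' l) (he' l) hx).inner_left G _)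
    (fun X _ ↦ .sum fun l _ ↦ isTensorialAt_inner hx G _) hκ he' horth]
  rw [Finset.sum_comm]
  rw [he.trace_eq hx (B := fun Y Z ↦ ∑ a, pair G (curvature D (e a) Y Z) (e a) x)
    (fun Z hZ ↦ .sum fun a _ ↦ (hD.curvature_tensorial_middle (he.sec a) hZ hx).inner_left G _)
    (fun Y hY ↦ .sum fun a _ ↦ (hD.curvature_tensorial_right (he.sec a) hY hx).inner_left G _)
    hκ he' horth]
  rw [Finset.sum_comm]

end IsOrthoFrame

end Connections

/-! ### The Levi-Civita connection in an orthonormal frame -/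

section LeviCivita

variable {E : Type*} [NormedAddCommGroup E] [NormedSpace ℝ E]
  {M : Type*} [TopologicalSpace M] [ChartedSpace E M]

theorem pair_congr (G : TMetric E M) {X X' Y Y' : VField E M} {x : M} (hX : X x = X' x)
    (hY : Y x = Y' x) : pair G X Y x = pair G X' Y' x := by
  simp only [pair, hX, hY]

theorem koszul_congr (G : TMetric E M) {U : Set M} (hU : IsOpen U) {X X' Y Y' Z Z' : VField E M}
    (hX : ∀ y ∈ U, X y = X' y) (hY : ∀ y ∈ U, Y y = Y' y) (hZ : ∀ y ∈ U, Z y = Z' y) {x : M}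
    (hx : x ∈ U) : koszul G X Y Z x = koszul G X' Y' Z' x := by
  have hp : ∀ {A A' B B' : VField E M}, (∀ y ∈ U, A y = A' y) → (∀ y ∈ U, B y = B' y) →
      Set.EqOn (pair G A B) (pair G A' B') U :=
    fun hA hB y hy ↦ pair_congr G (hA y hy) (hB y hy)
  have hd : ∀ {A A' B B' C C' : VField E M}, (∀ y ∈ U, A y = A' y) → (∀ y ∈ U, B y = B' y) →
      (∀ y ∈ U, C y = C' y) → dirDeriv C (pair G A B) x = dirDeriv C' (pair G A' B') x :=
    fun hA hB hC ↦ (dirDeriv_congr_left (hC x hx)).trans (dirDeriv_congr hU (hp hA hB) hx)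
  have hb : ∀ {A A' B B' C C' : VField E M}, (∀ y ∈ U, A y = A' y) → (∀ y ∈ U, B y = B' y) →
      (∀ y ∈ U, C y = C' y) → pair G (mlieBracket 𝓘(ℝ, E) A B) C x
        = pair G (mlieBracket 𝓘(ℝ, E) A' B') C' x :=
    fun hA hB hC ↦ pair_congr G (mlieBracket_congr hU hA hB hx) (hC x hx)
  simp only [koszul]
  rw [hd hY hZ hX, hd hX hZ hY, hd hX hY hZ, hb hX hY hZ, hb hX hZ hY, hb hY hZ hX]

theorem nabla_congr (G : TMetric E M) {U : Set M} (hU : IsOpen U) {X X' Y Y' : VField E M}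
    [IsManifold 𝓘(ℝ, E) ∞ M]
    (hX : ∀ y ∈ U, X y = X' y) (hY : ∀ y ∈ U, Y y = Y' y) {x : M} (hx : x ∈ U) :
    nabla G X Y x = nabla G X' Y' x := by
  simp only [nabla, koszul_congr G hU hX hY (fun _ _ ↦ rfl) hx]

variable [IsManifold 𝓘(ℝ, E) ∞ M]

/-- Finitely many tangent vectors at `x` extend to vector fields which are smooth on a common
neighborhood. -/
theorem exists_smoothOn_extend {U : Set M} (hU : IsOpen U) {x : M} (hx : x ∈ U) {κ : Type*}
    [Finite κ] (v : κ → TangentSpace 𝓘(ℝ, E) x) :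
    ∃ O ⊆ U, IsOpen O ∧ x ∈ O ∧ ∀ k, SmoothOn (FiberBundle.extend E (v k) : VField E M) O := by
  choose s hs hsm using fun k ↦
    FiberBundle.exists_contMDiffOn_extend (k := ∞) 𝓘(ℝ, E) E (V := TangentSpace 𝓘(ℝ, E)) (v k)
  have h : U ∩ ⋂ k, s k ∈ 𝓝 x := Filter.inter_mem (hU.mem_nhds hx) (Filter.iInter_mem.2 hs)
  obtain ⟨O, hOs, hO, hxO⟩ := mem_nhds_iff.1 h
  exact ⟨O, fun y hy ↦ (hOs hy).1, hO, hxO, fun k ↦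
    ContMDiffOn.mono (hsm k) fun y hy ↦ Set.mem_iInter.1 (hOs hy).2 k⟩

theorem IsOrthoFrame.ext_inner {G : TMetric E M} {U : Set M} {ι : Type*} [Fintype ι]
    [DecidableEq ι] {e : ι → VField E M} (he : IsOrthoFrame G (fun _ ↦ ⊤) U e) {x : M} (hx : x ∈ U)
    {v w : TangentSpace 𝓘(ℝ, E) x}
    (h : ∀ a, G.inner x v (e a x) = G.inner x w (e a x)) : v = w := by
  rw [he.expand x hx v Submodule.mem_top, he.expand x hx w Submodule.mem_top]
  simp only [h]

variable [FiniteDimensional ℝ E]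

namespace IsOrthoFrame

variable {G : TMetric E M} {U : Set M} {ι : Type*} [Fintype ι] [DecidableEq ι]
  {e : ι → VField E M}

section Koszul

variable (he : IsOrthoFrame G (fun _ ↦ ⊤) U e) {X X' Y Y' Z Z' : VField E M} {φ : M → ℝ}
  {x : M} (hx : x ∈ U)
include he hx

theorem koszul_add_right (hX : SmoothOn X U) (hY : SmoothOn Y U) (hZ : SmoothOn Z U)
    (hZ' : SmoothOn Z' U) :
    koszul G X Y (fun y ↦ Z y + Z' y) x = koszul G X Y Z x + koszul G X Y Z' x := by
  simp only [koszul, pair_add_right]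
  rw [dirDeriv_add he.isOpen hx (he.smoothFnOn_pair hY hZ) (he.smoothFnOn_pair hY hZ'),
    dirDeriv_add he.isOpen hx (he.smoothFnOn_pair hX hZ) (he.smoothFnOn_pair hX hZ'),
    dirDeriv_add_left]
  simp only [pair]
  rw [mlieBracket_fun_add_right he.isOpen hx hZ hZ', mlieBracket_fun_add_right he.isOpen hx hZ hZ']
  simp only [map_add, FunLike.coe_add, Pi.add_apply]
  ring

/-- The derivatives `X(φ)⟨Y, Z⟩` and `Y(φ)⟨X, Z⟩` of the first two terms are cancelled by those in
`[X, φZ]` and `[Y, φZ]`. This tensoriality in `Z` is what makes the Koszul expression represent a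
tangent vector. -/
theorem koszul_smul_right (hφ : SmoothFnOn E φ U) (hX : SmoothOn X U) (hY : SmoothOn Y U)
    (hZ : SmoothOn Z U) :
    koszul G X Y (fun y ↦ φ y • Z y) x = φ x * koszul G X Y Z x := by
  simp only [koszul, pair_smul_right]
  rw [dirDeriv_mul he.isOpen hx hφ (he.smoothFnOn_pair hY hZ),
    dirDeriv_mul he.isOpen hx hφ (he.smoothFnOn_pair hX hZ), dirDeriv_smul_left]
  simp only [pair]
  rw [mlieBracket_fun_smul_right he.isOpen hx hφ hZ, mlieBracket_fun_smul_right he.isOpen hx hφ hZ]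
  simp only [map_add, map_smul, FunLike.coe_add, FunLike.coe_smul, Pi.add_apply, Pi.smul_apply,
    smul_eq_mul]
  rw [G.symm x (Z x) (Y x), G.symm x (Z x) (X x)]
  ring

theorem koszul_add_left (hX : SmoothOn X U) (hX' : SmoothOn X' U) (hY : SmoothOn Y U)
    (hZ : SmoothOn Z U) :
    koszul G (fun y ↦ X y + X' y) Y Z x = koszul G X Y Z x + koszul G X' Y Z x := by
  simp only [koszul, pair_add_left, pair_add_right]
  rw [dirDeriv_add he.isOpen hx (he.smoothFnOn_pair hX hZ) (he.smoothFnOn_pair hX' hZ),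
    dirDeriv_add he.isOpen hx (he.smoothFnOn_pair hX hY) (he.smoothFnOn_pair hX' hY),
    dirDeriv_add_left]
  simp only [pair]
  rw [mlieBracket_fun_add_left he.isOpen hx hX hX', mlieBracket_fun_add_left he.isOpen hx hX hX']
  simp only [map_add, FunLike.coe_add, Pi.add_apply]
  ring

theorem koszul_smul_left (hφ : SmoothFnOn E φ U) (hX : SmoothOn X U) (hY : SmoothOn Y U)
    (hZ : SmoothOn Z U) :
    koszul G (fun y ↦ φ y • X y) Y Z x = φ x * koszul G X Y Z x := by
  simp only [koszul, pair_smul_left, pair_smul_right]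
  rw [dirDeriv_mul he.isOpen hx hφ (he.smoothFnOn_pair hX hZ),
    dirDeriv_mul he.isOpen hx hφ (he.smoothFnOn_pair hX hY), dirDeriv_smul_left]
  simp only [pair]
  rw [mlieBracket_fun_smul_left he.isOpen hx hφ hX, mlieBracket_fun_smul_left he.isOpen hx hφ hX]
  simp only [map_sub, map_smul, FunLike.coe_sub, FunLike.coe_smul, Pi.sub_apply, Pi.smul_apply,
    smul_eq_mul]
  ring

theorem koszul_add_middle (hX : SmoothOn X U) (hY : SmoothOn Y U) (hY' : SmoothOn Y' U)
    (hZ : SmoothOn Z U) :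
    koszul G X (fun y ↦ Y y + Y' y) Z x = koszul G X Y Z x + koszul G X Y' Z x := by
  simp only [koszul, pair_add_left, pair_add_right]
  rw [dirDeriv_add he.isOpen hx (he.smoothFnOn_pair hY hZ) (he.smoothFnOn_pair hY' hZ),
    dirDeriv_add he.isOpen hx (he.smoothFnOn_pair hX hY) (he.smoothFnOn_pair hX hY'),
    dirDeriv_add_left]
  simp only [pair]
  rw [mlieBracket_fun_add_left he.isOpen hx hY hY', mlieBracket_fun_add_right he.isOpen hx hY hY']
  simp only [map_add, FunLike.coe_add, Pi.add_apply]
  ring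

/-- Here the two terms in `X(φ)` add up instead of cancelling; this is the Leibniz rule for `∇`. -/
theorem koszul_smul_middle (hφ : SmoothFnOn E φ U) (hX : SmoothOn X U) (hY : SmoothOn Y U)
    (hZ : SmoothOn Z U) :
    koszul G X (fun y ↦ φ y • Y y) Z x
      = 2 * dirDeriv X φ x * pair G Y Z x + φ x * koszul G X Y Z x := by
  simp only [koszul, pair_smul_left, pair_smul_right]
  rw [dirDeriv_mul he.isOpen hx hφ (he.smoothFnOn_pair hY hZ),
    dirDeriv_mul he.isOpen hx hφ (he.smoothFnOn_pair hX hY), dirDeriv_smul_left]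
  simp only [pair]
  rw [mlieBracket_fun_smul_left he.isOpen hx hφ hY, mlieBracket_fun_smul_right he.isOpen hx hφ hY]
  simp only [map_add, map_sub, map_smul, FunLike.coe_add, FunLike.coe_sub, FunLike.coe_smul,
    Pi.add_apply, Pi.sub_apply, Pi.smul_apply, smul_eq_mul]
  rw [G.symm x (Y x) (X x)]
  ring

theorem koszul_tensorial_right (hX : SmoothOn X U) (hY : SmoothOn Y U) :
    IsTensorialAt (fun _ ↦ ⊤) U x (fun Z ↦ koszul G X Y Z x) where
  congr _ _ _ _ h := koszul_congr G he.isOpen (fun _ _ ↦ rfl) (fun _ _ ↦ rfl) h hx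
  add _ _ hZ hZ' := he.koszul_add_right hx hX hY hZ.smooth hZ'.smooth
  smul _ _ hφ hZ := he.koszul_smul_right hx hφ hX hY hZ.smooth

/-- The defining property of the Levi-Civita connection. -/
theorem inner_nabla (hX : SmoothOn X U) (hY : SmoothOn Y U) {O : Set M} (hO : IsOpen O)
    (hxO : x ∈ O) (hZ : SmoothOn Z O) :
    2 * G.inner x (nabla G X Y x) (Z x) = koszul G X Y Z x := by
  suffices h : ∃ w : TangentSpace 𝓘(ℝ, E) x,
      ∀ (V : Set M) (Z : VField E M), IsOpen V → x ∈ V → SmoothOn Z V →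
        2 * G.inner x w (Z x) = koszul G X Y Z x from
    Classical.epsilon_spec h O Z hO hxO hZ
  -- The frame components of the witness are forced by testing on `Z = e c`. Since `Z` is smooth
  -- only on `V`, the frame is restricted to `U ∩ V` before expanding in it.
  refine ⟨∑ c, (koszul G X Y (e c) x / 2) • e c x, fun V Z hV hxV hZ ↦ ?_⟩
  have heV := he.mono (O := U ∩ V) Set.inter_subset_left (he.isOpen.inter hV)
  have h := heV.tensorial_expand (heV.koszul_tensorial_right ⟨hx, hxV⟩
    (hX.mono Set.inter_subset_left) (hY.mono Set.inter_subset_left))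
    (.top (hZ.mono Set.inter_subset_right))
  rw [h]
  simp only [map_sum, map_smul, FunLike.coe_sum, Finset.sum_apply, FunLike.coe_smul,
    Pi.smul_apply, smul_eq_mul, Finset.mul_sum]
  refine Finset.sum_congr rfl fun c _ ↦ ?_
  rw [G.symm x (e c x)]
  simp only [pair]
  ring

theorem pair_nabla_frame (hX : SmoothOn X U) (hY : SmoothOn Y U) (c : ι) :
    pair G (nabla G X Y) (e c) x = koszul G X Y (e c) x / 2 := by
  have := he.inner_nabla hx hX hY he.isOpen hx (he.sec c).smooth
  simp only [pair]
  linarith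

/-- The Christoffel symbols of the Levi-Civita connection in an orthonormal frame. -/
theorem christoffel (a b c : ι) :
    pair G (nabla G (e a) (e b)) (e c) x
      = (pair G (mlieBracket 𝓘(ℝ, E) (e a) (e b)) (e c) x
        - pair G (mlieBracket 𝓘(ℝ, E) (e a) (e c)) (e b) x
        - pair G (mlieBracket 𝓘(ℝ, E) (e b) (e c)) (e a) x) / 2 := by
  rw [he.pair_nabla_frame hx (he.sec a).smooth (he.sec b).smooth, koszul]
  simp only [he.dirDeriv_pair _ _ hx]
  ring

end Koszul

/-- The curvature differentiates `∇_X Y` once more. Smoothness is not part of the pointwise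
definition; it follows from that of the frame coefficients, which are half the Koszul expressions.
-/
theorem smoothOn_nabla (he : IsOrthoFrame G (fun _ ↦ ⊤) U e) {X Y : VField E M}
    (hX : SmoothOn X U) (hY : SmoothOn Y U) : SmoothOn (nabla G X Y) U := by
  have hk : ∀ c, SmoothFnOn E (fun y ↦ koszul G X Y (e c) y / 2) U := fun c ↦ by
    have hc := (he.sec c).smooth
    have h1 := (he.smoothFnOn_pair hY hc).dirDeriv hX he.isOpen
    have h2 := (he.smoothFnOn_pair hX hc).dirDeriv hY he.isOpen
    have h3 := (he.smoothFnOn_pair hX hY).dirDeriv hc he.isOpen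
    have h4 := he.smoothFnOn_pair (hX.mlieBracket hY he.isOpen) hc
    have h5 := he.smoothFnOn_pair (hX.mlieBracket hc he.isOpen) hY
    have h6 := he.smoothFnOn_pair (hY.mlieBracket hc he.isOpen) hX
    exact ((((((h1.add h2).sub h3).add h4).sub h5).sub h6).div_const 2)
  refine SmoothOn.congr (.sum (s := Finset.univ) fun c _ ↦ .smul (hk c) (he.sec c).smooth)
    fun y hy ↦ ?_
  rw [he.expand y hy (nabla G X Y y) Submodule.mem_top]
  refine Finset.sum_congr rfl fun c _ ↦ ?_
  have := he.pair_nabla_frame hy hX hY c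
  rw [← this]
  rfl

theorem isConn_nabla (he : IsOrthoFrame G (fun _ ↦ ⊤) U e) :
    IsConn (fun _ ↦ ⊤) U (nabla G) where
  isOpen := he.isOpen
  sec X Y hX hY := .top (he.smoothOn_nabla hX.smooth hY.smooth)
  bracket X Y hX hY := .top (hX.smooth.mlieBracket hY.smooth he.isOpen)
  congr X X' Y Y' hX hY x hx := nabla_congr G he.isOpen hX hY hx
  add_left X X' Y hX hX' hY x hx := he.ext_inner hx fun c ↦ by
    have h0 := he.pair_nabla_frame hx (hX.smooth.add hX'.smooth) hY.smooth c
    have h1 := he.pair_nabla_frame hx hX.smooth hY.smooth c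
    have h2 := he.pair_nabla_frame hx hX'.smooth hY.smooth c
    have h3 := he.koszul_add_left hx hX.smooth hX'.smooth hY.smooth (he.sec c).smooth
    simp only [pair, map_add, FunLike.coe_add, Pi.add_apply] at h0 h1 h2 ⊢
    linarith
  smul_left φ X Y hφ hX hY x hx := he.ext_inner hx fun c ↦ by
    have h0 := he.pair_nabla_frame hx (.smul hφ hX.smooth) hY.smooth c
    have h1 := he.pair_nabla_frame hx hX.smooth hY.smooth c
    have h3 := he.koszul_smul_left hx hφ hX.smooth hY.smooth (he.sec c).smooth
    simp only [pair, map_smul, FunLike.coe_smul, Pi.smul_apply, smul_eq_mul] at h0 h1 ⊢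
    rw [h0, h1, h3]
    ring
  add_right X Y Y' hX hY hY' x hx := he.ext_inner hx fun c ↦ by
    have h0 := he.pair_nabla_frame hx hX.smooth (hY.smooth.add hY'.smooth) c
    have h1 := he.pair_nabla_frame hx hX.smooth hY.smooth c
    have h2 := he.pair_nabla_frame hx hX.smooth hY'.smooth c
    have h3 := he.koszul_add_middle hx hX.smooth hY.smooth hY'.smooth (he.sec c).smooth
    simp only [pair, map_add, FunLike.coe_add, Pi.add_apply] at h0 h1 h2 ⊢
    linarith
  leibniz φ X Y hφ hX hY x hx := he.ext_inner hx fun c ↦ by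
    have h0 := he.pair_nabla_frame hx hX.smooth (.smul hφ hY.smooth) c
    have h1 := he.pair_nabla_frame hx hX.smooth hY.smooth c
    have h3 := he.koszul_smul_middle hx hφ hX.smooth hY.smooth (he.sec c).smooth
    simp only [pair, map_add, map_smul, FunLike.coe_add, FunLike.coe_smul, Pi.add_apply,
      Pi.smul_apply, smul_eq_mul] at h0 h1 h3 ⊢
    rw [h0, h1, h3]
    ring

end IsOrthoFrame

/-- The scalar curvature computed in an orthonormal frame. -/
theorem IsOrthoFrame.scalarCurvature_eq {G : TMetric E M} {U : Set M} {ι : Type*} [Fintype ι]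
    [DecidableEq ι] {e : ι → VField E M} (he : IsOrthoFrame G (fun _ ↦ ⊤) U e)
    (hι : Fintype.card ι = Module.finrank ℝ E) {x : M} (hx : x ∈ U) :
    scalarCurvature G x = ∑ a, ∑ b, pair G (curvature (nabla G) (e a) (e b) (e b)) (e a) x := by
  let : RiemannianBundle (fun x : M ↦ TangentSpace 𝓘(ℝ, E) x) := ⟨G⟩
  let b := stdOrthonormalBasis ℝ (TangentSpace 𝓘(ℝ, E) x)
  -- The extended basis is smooth only near `x` and orthonormal only at `x`, which suffices for
  -- `sum_curvature_eq` on a smaller neighborhood.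
  obtain ⟨O, hOU, hO, hxO, hsm⟩ := exists_smoothOn_extend he.isOpen hx (fun a ↦ b a)
  have heO := he.mono hOU hO
  refine heO.sum_curvature_eq heO.isConn_nabla hxO (e' := fun a ↦ FiberBundle.extend E (b a))
    ?_ (fun k ↦ .top (hsm k)) fun k l ↦ ?_
  · rw [hι, Fintype.card_fin]
    rfl
  · simp only [pair, FiberBundle.extend_apply_self]
    exact orthonormal_iff_ite.1 b.orthonormal k l

end LeviCivita

/-! ### Adapted frames, the adiabatic metrics and the leafwise connection -/

section Adapted

variable {E : Type*} [NormedAddCommGroup E] [NormedSpace ℝ E]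
  {M : Type*} [TopologicalSpace M] [ChartedSpace E M]

theorem eq_sum_inner_of_orthonormal [FiniteDimensional ℝ E] (g : TMetric E M) {y : M}
    {W : Submodule ℝ (TangentSpace 𝓘(ℝ, E) y)} {ι : Type*} [Fintype ι] [DecidableEq ι]
    {u : ι → TangentSpace 𝓘(ℝ, E) y}
    (hu : ∀ a, u a ∈ W) (horth : ∀ a b, g.inner y (u a) (u b) = if a = b then 1 else 0)
    (hcard : Fintype.card ι = Module.finrank ℝ W) {v : TangentSpace 𝓘(ℝ, E) y} (hv : v ∈ W) :
    v = ∑ a, g.inner y v (u a) • u a := by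
  have hcoef : ∀ (c : ι → ℝ) (b : ι), g.inner y (∑ a, c a • u a) (u b) = c b := by
    intro c b
    simp [horth]
  have hli : LinearIndependent ℝ u := by
    rw [Fintype.linearIndependent_iff]
    intro c hc b
    rw [← hcoef c b, hc]
    simp
  have hspan : Submodule.span ℝ (Set.range u) = W := by
    refine Submodule.eq_of_le_of_finrank_eq (Submodule.span_le.2 ?_) ?_
    · rintro _ ⟨a, rfl⟩
      exact hu a
    · rw [finrank_span_eq_card hli, hcard]
  rw [← hspan, Submodule.mem_span_range_iff_exists_fun] at hv
  obtain ⟨c, rfl⟩ := hv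
  exact Finset.sum_congr rfl fun a _ ↦ by rw [hcoef]

theorem IsSubbundle.finrank_eq [IsManifold 𝓘(ℝ, E) ∞ M] {F : Distrib E M} {p : ℕ}
    (hF : IsSubbundle F p) (y : M) : Module.finrank ℝ (F y) = p := by
  obtain ⟨U, -, hy, s, -, hs⟩ := hF y
  obtain ⟨hli, hspan⟩ := hs y hy
  rw [← hspan, finrank_span_eq_card hli, Fintype.card_fin]

variable [FiniteDimensional ℝ E] (g : TMetric E M) (F : Distrib E M)

theorem proj_mem (y : M) (v : TangentSpace 𝓘(ℝ, E) y) : proj g F y v ∈ F y := by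
  let _ : RiemannianBundle (fun x : M ↦ TangentSpace 𝓘(ℝ, E) x) := ⟨g⟩
  exact Submodule.starProjection_apply_mem (F y) v

theorem inner_proj_of_mem (y : M) (v : TangentSpace 𝓘(ℝ, E) y) {w : TangentSpace 𝓘(ℝ, E) y}
    (hw : w ∈ F y) : g.inner y (proj g F y v) w = g.inner y v w := by
  have h : g.inner y (v - proj g F y v) w = 0 := by
    let _ : RiemannianBundle (fun x : M ↦ TangentSpace 𝓘(ℝ, E) x) := ⟨g⟩
    exact (F y).starProjection_inner_eq_zero v w hw
  simp only [map_sub, FunLike.coe_sub, Pi.sub_apply] at h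
  linarith

theorem proj_of_mem (y : M) {v : TangentSpace 𝓘(ℝ, E) y} (hv : v ∈ F y) : proj g F y v = v := by
  let _ : RiemannianBundle (fun x : M ↦ TangentSpace 𝓘(ℝ, E) x) := ⟨g⟩
  exact Submodule.starProjection_eq_self_iff.2 hv

/-- The orthogonal complement of `F`. -/
noncomputable def orthDistrib : Distrib E M := fun y ↦ LinearMap.ker (proj g F y).toLinearMap

variable {g F}

theorem mem_orthDistrib {y : M} {v : TangentSpace 𝓘(ℝ, E) y} :
    v ∈ orthDistrib g F y ↔ proj g F y v = 0 := LinearMap.mem_ker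

theorem coproj_of_mem_orthDistrib {y : M} {v : TangentSpace 𝓘(ℝ, E) y}
    (hv : v ∈ orthDistrib g F y) : coproj g F y v = v := by
  change v - proj g F y v = v
  rw [mem_orthDistrib.1 hv, sub_zero]

theorem coproj_mem_orthDistrib {y : M} (v : TangentSpace 𝓘(ℝ, E) y) :
    coproj g F y v ∈ orthDistrib g F y := by
  rw [mem_orthDistrib]
  change proj g F y (v - proj g F y v) = 0
  rw [map_sub, proj_of_mem g F y (proj_mem g F y _), sub_self]

variable [IsManifold 𝓘(ℝ, E) ∞ M] {p q : ℕ}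

/-- An adapted orthonormal frame of a smooth metric, seen as a frame of the tangent bundle, of `F`
and of its orthogonal complement. -/
structure IsAdapted (g : TMetric E M) (F : Distrib E M) (U : Set M) (f : Fin p → VField E M)
    (h : Fin q → VField E M) : Prop where
  full : IsOrthoFrame g (fun _ ↦ ⊤) U (Sum.elim f h)
  leaf : IsOrthoFrame g F U f
  normal : IsOrthoFrame g (orthDistrib g F) U h
  integrable : IsIntegrable F
  finrank_leaf : ∀ y, Module.finrank ℝ (F y) = p
  finrank_full : p + q = Module.finrank ℝ E

variable {U : Set M} {f : Fin p → VField E M} {h : Fin q → VField E M}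

theorem IsAdaptedFrame.isAdapted (hfh : IsAdaptedFrame g F U f h)
    (hpq : p + q = Module.finrank ℝ E) (hF : IsSubbundle F p) (hint : IsIntegrable F)
    (hU : IsOpen U)
    (hg : ∀ O : Set M, IsOpen O → ∀ X Y, SmoothOn X O → SmoothOn Y O →
      SmoothFnOn E (pair g X Y) O) : IsAdapted g F U f h := by
  have hfull : IsOrthoFrame g (fun _ ↦ ⊤) U (Sum.elim f h) := by
    have ho : ∀ a b, ∀ y ∈ U, pair g (Sum.elim f h a) (Sum.elim f h b) y
        = if a = b then 1 else 0 := by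
      rintro (i | s) (j | t) y hy
      · simpa using! hfh.orthonormal_f i j y hy
      · simpa [pair] using (g.symm y _ _).trans (hfh.perp_h t y hy _ (hfh.mem_f i y hy))
      · simpa [pair] using hfh.perp_h s y hy _ (hfh.mem_f j y hy)
      · simpa using! hfh.orthonormal_h s t y hy
    refine ⟨hU, fun O _ ↦ hg O, ?_, ho, fun y hy v hv ↦ ?_⟩
    · rintro (i | s)
      · exact .top (hfh.smooth_f i)
      · exact .top (hfh.smooth_h s)
    · refine eq_sum_inner_of_orthonormal (u := fun a ↦ Sum.elim f h a y) g
        (fun _ ↦ Submodule.mem_top) (fun a b ↦ ho a b y hy) ?_ hv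
      rw [finrank_top, Fintype.card_sum, Fintype.card_fin, Fintype.card_fin, hpq]
      rfl
  refine ⟨hfull, ⟨hU, fun O _ ↦ hg O, fun i ↦ ⟨hfh.smooth_f i, hfh.mem_f i⟩, hfh.orthonormal_f,
    fun y hy v hv ↦ ?_⟩, ⟨hU, fun O _ ↦ hg O, fun s ↦ ⟨hfh.smooth_h s, fun y hy ↦ ?_⟩,
    hfh.orthonormal_h, fun y hy v hv ↦ ?_⟩, hint, hF.finrank_eq, hpq⟩
  · refine eq_sum_inner_of_orthonormal (u := fun i ↦ f i y) g (fun i ↦ hfh.mem_f i y hy)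
      (fun i j ↦ hfh.orthonormal_f i j y hy) ?_ hv
    rw [hF.finrank_eq, Fintype.card_fin]
  · rw [mem_orthDistrib]
    -- For `h_s` orthogonal to `F` one has `⟨p h_s, p h_s⟩ = ⟨h_s, p h_s⟩ = 0`, so positivity forces
    -- `p h_s = 0`.
    by_contra hne
    have h1 := g.pos y _ hne
    rw [inner_proj_of_mem g F y _ (proj_mem g F y _),
      hfh.perp_h s y hy _ (proj_mem g F y _)] at h1
    exact lt_irrefl _ h1
  · have h1 := hfull.expand y hy v Submodule.mem_top
    rw [Fintype.sum_sum_type] at h1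
    have h2 : ∀ i, g.inner y v (f i y) = 0 := fun i ↦ by
      rw [← inner_proj_of_mem g F y v (hfh.mem_f i y hy), mem_orthDistrib.1 hv]
      simp
    simpa [h2] using h1

namespace IsAdapted

theorem mono (ha : IsAdapted g F U f h) {O : Set M} (hOU : O ⊆ U) (hO : IsOpen O) :
    IsAdapted g F O f h :=
  ⟨ha.full.mono hOU hO, ha.leaf.mono hOU hO, ha.normal.mono hOU hO, ha.integrable,
    ha.finrank_leaf, ha.finrank_full⟩

variable (ha : IsAdapted g F U f h) {y : M} (hy : y ∈ U)
include ha hy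

theorem proj_eq (v : TangentSpace 𝓘(ℝ, E) y) :
    proj g F y v = ∑ i, g.inner y v (f i y) • f i y := by
  rw [ha.leaf.expand y hy _ (proj_mem g F y v)]
  refine Finset.sum_congr rfl fun i _ ↦ ?_
  rw [inner_proj_of_mem g F y v ((ha.leaf.sec i).mem y hy)]

theorem coproj_eq (v : TangentSpace 𝓘(ℝ, E) y) :
    coproj g F y v = ∑ s, g.inner y v (h s y) • h s y := by
  have h1 := ha.full.expand y hy v Submodule.mem_top
  rw [Fintype.sum_sum_type] at h1
  change v - proj g F y v = _
  rw [ha.proj_eq hy, sub_eq_iff_eq_add']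
  exact h1

theorem inner_f_f (i j : Fin p) : g.inner y (f i y) (f j y) = if i = j then 1 else 0 :=
  ha.leaf.orthonormal i j y hy

theorem inner_h_h (s t : Fin q) : g.inner y (h s y) (h t y) = if s = t then 1 else 0 :=
  ha.normal.orthonormal s t y hy

theorem inner_f_h (i : Fin p) (s : Fin q) : g.inner y (f i y) (h s y) = 0 := by
  simpa using! ha.full.orthonormal (.inl i) (.inr s) y hy

theorem inner_h_f (s : Fin q) (i : Fin p) : g.inner y (h s y) (f i y) = 0 := by
  simpa using! ha.full.orthonormal (.inr s) (.inl i) y hy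

theorem inner_mem_h {v : TangentSpace 𝓘(ℝ, E) y} (hv : v ∈ F y) (s : Fin q) :
    g.inner y v (h s y) = 0 := by
  rw [g.symm, ← inner_proj_of_mem g F y _ hv, mem_orthDistrib.1 ((ha.normal.sec s).mem y hy)]
  simp

theorem inner_coproj_h (v : TangentSpace 𝓘(ℝ, E) y) (s : Fin q) :
    g.inner y (coproj g F y v) (h s y) = g.inner y v (h s y) := by
  rw [ha.coproj_eq hy]
  simp [ha.inner_h_h hy]

theorem adiabatic_inner (ε : Set.Ioi (0 : ℝ)) (v w : TangentSpace 𝓘(ℝ, E) y) :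
    (adiabatic g F ε).inner y v w = ∑ i, g.inner y v (f i y) * g.inner y w (f i y)
      + (ε : ℝ)⁻¹ * ∑ s, g.inner y v (h s y) * g.inner y w (h s y) := by
  change adiabaticForm g F ε y v w = _
  rw [adiabaticForm_apply]
  congr 1
  · rw [inner_proj_of_mem g F y v (proj_mem g F y w), ha.proj_eq hy w]
    simp [mul_comm]
  · congr 1
    rw [ha.coproj_eq hy w]
    simp only [map_sum, map_smul, smul_eq_mul, ha.inner_coproj_h hy]
    simp [mul_comm]

end IsAdapted

/-- The scaling factors turning an orthonormal frame of `g` into one of the adiabatic metric. -/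
noncomputable def frameScale (p q : ℕ) (r : ℝ) : Fin p ⊕ Fin q → ℝ :=
  Sum.elim (fun _ ↦ 1) (fun _ ↦ r)

/-- The adapted frame rescaled by `r` in the normal directions. -/
noncomputable def scaledFrame (f : Fin p → VField E M) (h : Fin q → VField E M) (r : ℝ) :
    Fin p ⊕ Fin q → VField E M :=
  fun a y ↦ frameScale p q r a • Sum.elim f h a y

namespace IsAdapted

/-- In a normal direction the metric contributes `1/ε` and the frame vector `√ε`; the product is the
inverse of the scale. -/
theorem adiabatic_inner_scaledFrame (ha : IsAdapted g F U f h) {y : M} (hy : y ∈ U)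
    (ε : Set.Ioi (0 : ℝ)) (v : TangentSpace 𝓘(ℝ, E) y) (a : Fin p ⊕ Fin q) :
    (adiabatic g F ε).inner y v (scaledFrame f h √ε a y)
      = (frameScale p q √ε a)⁻¹ * g.inner y v (Sum.elim f h a y) := by
  have hε : (0 : ℝ) < ε := ε.2
  rw [ha.adiabatic_inner hy]
  rcases a with i | s
  · simp [scaledFrame, frameScale, ha.inner_f_f hy, ha.inner_f_h hy]
  · simp only [scaledFrame, frameScale, Sum.elim_inr, map_smul, FunLike.coe_smul, Pi.smul_apply,
      ha.inner_h_f hy, ha.inner_h_h hy, smul_eq_mul, mul_zero, Finset.sum_const_zero, zero_add,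
      mul_ite, mul_one, Finset.sum_ite_eq, Finset.mem_univ, if_true]
    have h1 : √(ε : ℝ) * √(ε : ℝ) = ε := Real.mul_self_sqrt hε.le
    have h2 : √(ε : ℝ) ≠ 0 := (Real.sqrt_pos.2 hε).ne'
    rw [show (ε : ℝ)⁻¹ = (√(ε : ℝ))⁻¹ * (√(ε : ℝ))⁻¹ by rw [← mul_inv, h1]]
    field_simp

theorem frameScale_ne_zero {r : ℝ} (hr : r ≠ 0) (a : Fin p ⊕ Fin q) : frameScale p q r a ≠ 0 := by
  rcases a with i | s <;> simp [frameScale, hr]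

theorem adiabatic_frame (ha : IsAdapted g F U f h) (ε : Set.Ioi (0 : ℝ)) :
    IsOrthoFrame (adiabatic g F ε) (fun _ ↦ ⊤) U (scaledFrame f h √ε) where
  isOpen := ha.full.isOpen
  smooth_pair O hOU hO X Y hX hY := by
    have hf : ∀ {X : VField E M} (i : Fin p), SmoothOn X O → SmoothFnOn E (pair g X (f i)) O :=
      fun i hX ↦ ha.full.smooth_pair O hOU hO _ _ hX ((ha.leaf.sec i).smooth.mono hOU)
    have hh : ∀ {X : VField E M} (s : Fin q), SmoothOn X O → SmoothFnOn E (pair g X (h s)) O :=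
      fun s hX ↦ ha.full.smooth_pair O hOU hO _ _ hX ((ha.normal.sec s).smooth.mono hOU)
    have h1 : SmoothFnOn E (fun y ↦ ∑ i, pair g X (f i) y * pair g Y (f i) y) O :=
      contMDiffOn_finsetSum fun i _ ↦ ContMDiffOn.mul (hf i hX) (hf i hY)
    have h2 : SmoothFnOn E (fun y ↦ ∑ s, pair g X (h s) y * pair g Y (h s) y) O :=
      contMDiffOn_finsetSum fun s _ ↦ ContMDiffOn.mul (hh s hX) (hh s hY)
    have h3 : SmoothFnOn E (fun y ↦ (ε : ℝ)⁻¹ * ∑ s, pair g X (h s) y * pair g Y (h s) y) O :=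
      ContMDiffOn.mul contMDiffOn_const h2
    exact (ContMDiffOn.add h1 h3).congr fun y hy ↦ ha.adiabatic_inner (hOU hy) ε _ _
  sec a := .smul (φ := fun _ ↦ frameScale p q √ε a) contMDiffOn_const (ha.full.sec a)
  orthonormal a b y hy := by
    have hb := frameScale_ne_zero (p := p) (q := q) (Real.sqrt_pos.2 ε.2).ne' b
    have hab : g.inner y (Sum.elim f h a y) (Sum.elim f h b y) = if a = b then 1 else 0 :=
      ha.full.orthonormal a b y hy
    rw [pair, ha.adiabatic_inner_scaledFrame hy]
    simp only [scaledFrame, map_smul, FunLike.coe_smul, Pi.smul_apply, hab, smul_eq_mul]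
    split_ifs with heq
    · rw [heq, mul_one, inv_mul_cancel₀ hb]
    · simp
  expand y hy v hv := by
    conv_lhs => rw [ha.full.expand y hy v hv]
    refine Finset.sum_congr rfl fun a _ ↦ ?_
    have hb := frameScale_ne_zero (p := p) (q := q) (Real.sqrt_pos.2 ε.2).ne' a
    rw [ha.adiabatic_inner_scaledFrame hy, scaledFrame, smul_smul]
    congr 1
    field_simp

theorem tang_sec (ha : IsAdapted g F U f h) {X : VField E M} (hX : SmoothOn X U) :
    IsSec F U (tang g F X) := by
  refine ⟨SmoothOn.congr (.sum (s := Finset.univ) fun i _ ↦ .smul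
    (ha.full.smoothFnOn_pair hX (ha.leaf.sec i).smooth) (ha.leaf.sec i).smooth)
    fun y hy ↦ ha.proj_eq hy (X y), fun y _ ↦ proj_mem g F y _⟩

theorem tang_of_sec {X : VField E M} (hX : IsSec F U X) : ∀ y ∈ U, tang g F X y = X y :=
  fun y hy ↦ proj_of_mem g F y (hX.mem y hy)

theorem nablaF_eq (ha : IsAdapted g F U f h) (X : VField E M) {Y : VField E M}
    (hY : IsSec F U Y) : ∀ y ∈ U, nablaF g F X Y y = tang g F (nabla g X Y) y := by
  intro y hy
  simp only [nablaF, tang]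
  congr 1
  exact nabla_congr g ha.full.isOpen (fun _ _ ↦ rfl) (tang_of_sec hY) hy

/-- All the rules are projected from those of `∇`, using that `p` is the identity on sections of
`F`. Integrability enters in the closure of sections under the bracket. -/
theorem isConn_nablaF (ha : IsAdapted g F U f h) : IsConn F U (nablaF g F) := by
  have hn := ha.full.isConn_nabla
  have ht : ∀ {X : VField E M}, IsSec F U X → IsSec (fun _ ↦ ⊤) U X := fun hX ↦ .top hX.smooth
  refine ⟨hn.isOpen, fun X Y hX hY ↦ ?_, fun X Y hX hY ↦ ?_, fun X X' Y Y' hX hY x hx ↦ ?_,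
    fun X X' Y hX hX' hY x hx ↦ ?_, fun φ X Y hφ hX hY x hx ↦ ?_,
    fun X Y Y' hX hY hY' x hx ↦ ?_, fun φ X Y hφ hX hY x hx ↦ ?_⟩
  · exact ha.tang_sec (ha.full.smoothOn_nabla hX.smooth (ha.tang_sec hY.smooth).smooth)
  · exact ⟨hX.smooth.mlieBracket hY.smooth hn.isOpen,
      ha.integrable U X Y hn.isOpen hX.smooth hY.smooth hX.mem hY.mem⟩
  · change proj g F x (nabla g X (tang g F Y) x) = proj g F x (nabla g X' (tang g F Y') x)
    rw [nabla_congr g hn.isOpen hX (Y' := tang g F Y')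
      (fun y hy ↦ by simp only [tang]; rw [hY y hy]) hx]
  · rw [ha.nablaF_eq _ hY x hx, ha.nablaF_eq _ hY x hx, ha.nablaF_eq _ hY x hx]
    simp only [tang]
    rw [hn.add_left X X' Y (ht hX) (ht hX') (ht hY) x hx, map_add]
  · rw [ha.nablaF_eq _ hY x hx, ha.nablaF_eq _ hY x hx]
    simp only [tang]
    rw [hn.smul_left φ X Y hφ (ht hX) (ht hY) x hx, map_smul]
  · rw [ha.nablaF_eq _ (hY.add hY') x hx, ha.nablaF_eq _ hY x hx, ha.nablaF_eq _ hY' x hx]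
    simp only [tang]
    rw [hn.add_right X Y Y' (ht hX) (ht hY) (ht hY') x hx, map_add]
  · rw [ha.nablaF_eq _ (.smul hφ hY) x hx, ha.nablaF_eq _ hY x hx]
    simp only [tang]
    rw [hn.leibniz φ X Y hφ (ht hX) (ht hY) x hx, map_add, map_smul, map_smul,
      proj_of_mem g F x (hY.mem x hx)]

/-- The leafwise scalar curvature computed in an orthonormal frame. -/
theorem leafScalarCurvature_eq (ha : IsAdapted g F U f h) {x : M} (hx : x ∈ U) :
    leafScalarCurvature g F x
      = ∑ i, ∑ j, pair g (curvature (nablaF g F) (f i) (f j) (f j)) (f i) x := by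
  let : RiemannianBundle (fun x : M ↦ TangentSpace 𝓘(ℝ, E) x) := ⟨g⟩
  let b := stdOrthonormalBasis ℝ (F x)
  obtain ⟨O, hOU, hO, hxO, hsm⟩ := exists_smoothOn_extend ha.full.isOpen hx
    (fun a ↦ (b a : TangentSpace 𝓘(ℝ, E) x))
  have haO := ha.mono hOU hO
  refine haO.leaf.sum_curvature_eq haO.isConn_nablaF hxO
    (e' := fun a ↦ tang g F (FiberBundle.extend E (b a : TangentSpace 𝓘(ℝ, E) x)))
    ?_ (fun k ↦ haO.tang_sec (hsm k)) fun k l ↦ ?_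
  · rw [Fintype.card_fin, Fintype.card_fin, ha.finrank_leaf]
  · simp only [pair, tang, FiberBundle.extend_apply_self]
    rw [proj_of_mem g F x (b k).2, proj_of_mem g F x (b l).2]
    exact orthonormal_iff_ite.1 b.orthonormal k l

end IsAdapted

end Adapted

/-! ### The form `ω` and the function `Φ` in an adapted frame -/

section Omega

variable {E : Type*} [NormedAddCommGroup E] [NormedSpace ℝ E]
  {M : Type*} [TopologicalSpace M] [ChartedSpace E M]

/-- The structure functions `⟨[e_a, e_b], e_c⟩` of a frame. -/
noncomputable def structFn (g : TMetric E M) {ι : Type*} (e : ι → VField E M) (a b c : ι) : M → ℝ :=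
  pair g (mlieBracket 𝓘(ℝ, E) (e a) (e b)) (e c)

theorem structFn_skew (g : TMetric E M) {ι : Type*} (e : ι → VField E M) (a b c : ι) (x : M) :
    structFn g e a b c x = - structFn g e b a c x := by
  simp only [structFn, pair]
  rw [mlieBracket_skew (e a) (e b)]
  simp

theorem structFn_self (g : TMetric E M) {ι : Type*} (e : ι → VField E M) (a c : ι) (x : M) :
    structFn g e a a c x = 0 := by
  have := structFn_skew g e a a c x
  linarith

variable [FiniteDimensional ℝ E] [IsManifold 𝓘(ℝ, E) ∞ M] {g : TMetric E M} {F : Distrib E M}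
  {p q : ℕ} {U : Set M} {f : Fin p → VField E M} {h : Fin q → VField E M}

theorem IsOrthoFrame.smoothFnOn_structFn {W : Distrib E M} {ι : Type*} [Fintype ι] [DecidableEq ι]
    {e : ι → VField E M} (he : IsOrthoFrame g W U e) (a b c : ι) :
    SmoothFnOn E (structFn g e a b c) U :=
  he.smoothFnOn_pair ((he.sec a).smooth.mlieBracket (he.sec b).smooth he.isOpen) (he.sec c).smooth

namespace IsAdapted

variable (ha : IsAdapted g F U f h) {x : M} (hx : x ∈ U)
include ha hx

/-- The term `X(φ)⟨Y, V⟩` of the derivative cancels the one from `p^⊥[X, φV]`, because `p^⊥ V = V`.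
-/
theorem dual_tensorial {X Y : VField E M} (hY : SmoothOn Y U) :
    IsTensorialAt (orthDistrib g F) U x
      (fun V ↦ dirDeriv X (pair g Y V) x - pair g Y (bott g F X V) x) where
  congr V V' _ _ hV := by
    rw [dirDeriv_congr ha.full.isOpen (ψ := pair g Y V')
      (fun y hy ↦ pair_congr g rfl (hV y hy)) hx]
    simp only [pair, bott, perp]
    rw [mlieBracket_congr ha.full.isOpen (fun _ _ ↦ rfl) hV hx]
  add V V' hV hV' := by
    rw [pair_add_right, dirDeriv_add ha.full.isOpen hx (ha.full.smoothFnOn_pair hY hV.smooth)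
      (ha.full.smoothFnOn_pair hY hV'.smooth)]
    simp only [pair, bott, perp]
    rw [mlieBracket_fun_add_right ha.full.isOpen hx hV.smooth hV'.smooth]
    simp only [map_add]
    ring
  smul φ V hφ hV := by
    rw [pair_smul_right, dirDeriv_mul ha.full.isOpen hx hφ (ha.full.smoothFnOn_pair hY hV.smooth)]
    simp only [pair, bott, perp]
    rw [mlieBracket_fun_smul_right ha.full.isOpen hx hφ hV.smooth]
    simp only [map_add, map_smul, coproj_of_mem_orthDistrib (hV.mem x hx), smul_eq_mul]
    ring

/-- The defining property of the dual of the Bott connection. -/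
theorem bottDual_spec {X Y : VField E M} (hY : SmoothOn Y U) (t : Fin q) :
    dirDeriv X (pair g Y (h t)) x
      = g.inner x (bottDual g F X Y x) (h t x) + pair g Y (bott g F X (h t)) x := by
  suffices hex : ∃ w : TangentSpace 𝓘(ℝ, E) x, proj g F x w = 0 ∧
      ∀ (O : Set M) (V : VField E M), IsOpen O → x ∈ O → SmoothOn V O →
        (∀ y ∈ O, proj g F y (V y) = 0) →
        dirDeriv X (pair g Y V) x = g.inner x w (V x) + pair g Y (bott g F X V) x from
    (Classical.epsilon_spec hex).2 U (h t) ha.full.isOpen hx (ha.normal.sec t).smooth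
      fun y hy ↦ mem_orthDistrib.1 ((ha.normal.sec t).mem y hy)
  -- The components are dictated by the condition at `V = h_t`; tensoriality in `V` extends it to
  -- every local section of `F^⊥`.
  refine ⟨∑ t, (dirDeriv X (pair g Y (h t)) x - pair g Y (bott g F X (h t)) x) • h t x, ?_,
    fun O V hO hxO hV hVmem ↦ ?_⟩
  · simp only [map_sum, map_smul, mem_orthDistrib.1 ((ha.normal.sec _).mem x hx), smul_zero,
      Finset.sum_const_zero]
  · have haO := ha.mono (O := U ∩ O) Set.inter_subset_left (ha.full.isOpen.inter hO)
    have hT := haO.normal.tensorial_expand (haO.dual_tensorial ⟨hx, hxO⟩ (X := X)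
      (hY.mono Set.inter_subset_left)) (X := V) ⟨hV.mono Set.inter_subset_right,
        fun y hy ↦ mem_orthDistrib.2 (hVmem y hy.2)⟩
    rw [← sub_eq_iff_eq_add, hT]
    simp only [map_sum, map_smul, FunLike.coe_sum, Finset.sum_apply, FunLike.coe_smul,
      Pi.smul_apply, smul_eq_mul]
    refine Finset.sum_congr rfl fun t _ ↦ ?_
    rw [g.symm x (h t x)]
    simp only [pair]
    ring

/-- As `⟨h_s, h_t⟩` is constant, the dual connection is minus the transpose of the Bott connection
in this frame. So `ω` is minus the sum of the Bott matrix and its transpose, and in particular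
symmetric. -/
theorem omega_frame (X : VField E M) (s t : Fin q) :
    omega g F X (h s) (h t) x = - pair g (mlieBracket 𝓘(ℝ, E) X (h s)) (h t) x
      - pair g (mlieBracket 𝓘(ℝ, E) X (h t)) (h s) x := by
  have h1 := ha.bottDual_spec hx (X := X) (ha.normal.sec s).smooth t
  rw [ha.normal.dirDeriv_pair s t hx, pair_symm g (h s)] at h1
  simp only [omega, pair, bott, perp, map_sub, FunLike.coe_sub, Pi.sub_apply,
    ha.inner_coproj_h hx] at h1 ⊢
  linarith

/-- The extra term `-h_s(φ) X` in `[φX, h_s]` lies in `F`, hence is orthogonal to `h_t`. This lets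
`ω` be evaluated on the fields `p∇_Y Z` occurring in `Φ`. -/
theorem pair_bracket_tensorial (s t : Fin q) :
    IsTensorialAt F U x (fun X ↦ pair g (mlieBracket 𝓘(ℝ, E) X (h s)) (h t) x) where
  congr X X' _ _ hX := pair_congr g
    (mlieBracket_congr ha.full.isOpen hX (fun _ _ ↦ rfl) hx) rfl
  add X X' hX hX' := by
    simp only [pair]
    rw [mlieBracket_fun_add_left ha.full.isOpen hx hX.smooth hX'.smooth]
    simp
  smul φ X hφ hX := by
    simp only [pair]
    rw [mlieBracket_fun_smul_left ha.full.isOpen hx hφ hX.smooth]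
    simp [ha.inner_mem_h hx (hX.mem x hx)]

theorem omega_expand {X : VField E M} (hX : IsSec F U X) (s t : Fin q) :
    omega g F X (h s) (h t) x = ∑ i, pair g X (f i) x * omega g F (f i) (h s) (h t) x := by
  simp only [ha.omega_frame hx]
  rw [ha.leaf.tensorial_expand (ha.pair_bracket_tensorial hx s t) hX,
    ha.leaf.tensorial_expand (ha.pair_bracket_tensorial hx t s) hX]
  simp only [smul_eq_mul, mul_sub, mul_neg, Finset.sum_sub_distrib, Finset.sum_neg_distrib]

theorem omega_tang {X : VField E M} (hX : SmoothOn X U) (s t : Fin q) :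
    omega g F (tang g F X) (h s) (h t) x
      = ∑ i, pair g X (f i) x * omega g F (f i) (h s) (h t) x := by
  rw [ha.omega_expand hx (ha.tang_sec hX)]
  refine Finset.sum_congr rfl fun i _ ↦ ?_
  simp only [pair, tang]
  rw [inner_proj_of_mem g F x _ ((ha.leaf.sec i).mem x hx)]

theorem omega_right (X Y : VField E M) {V : VField E M} (hV : V x ∈ orthDistrib g F x) :
    omega g F X Y V x = ∑ t, pair g V (h t) x * omega g F X Y (h t) x := by
  have h1 := ha.normal.expand x hx (V x) hV
  simp only [omega]
  conv_lhs => rw [pair, h1]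
  simp [pair]

theorem omega_eq_structFn (i : Fin p) (s t : Fin q) :
    omega g F (f i) (h s) (h t) x = - (structFn g (Sum.elim f h) (.inl i) (.inr s) (.inr t) x
      + structFn g (Sum.elim f h) (.inl i) (.inr t) (.inr s) x) := by
  rw [ha.omega_frame hx]
  simp only [structFn, Sum.elim_inl, Sum.elim_inr]
  ring

-- Needed because `Φ` contains the bracket of `f_i` with `A_{is}`, whose coefficients are values of
-- `ω`.
omit hx in
theorem smoothFnOn_omega (i : Fin p) (s t : Fin q) :
    SmoothFnOn E (omega g F (f i) (h s) (h t)) U := by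
  refine ContMDiffOn.congr (f := fun y ↦
    -(structFn g (Sum.elim f h) (.inl i) (.inr s) (.inr t) y
      + structFn g (Sum.elim f h) (.inl i) (.inr t) (.inr s) y)) ?_
    fun y hy ↦ ha.omega_eq_structFn hy i s t
  exact ((ha.full.smoothFnOn_structFn _ _ _).add (ha.full.smoothFnOn_structFn _ _ _)).neg

theorem secA_mem (X Y : VField E M) : secA g F h X Y x ∈ orthDistrib g F x :=
  Submodule.smul_mem _ _ (Submodule.sum_mem _ fun t _ ↦
    Submodule.smul_mem _ _ ((ha.normal.sec t).mem x hx))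

theorem pair_secA (X Y : VField E M) (t : Fin q) :
    pair g (secA g F h X Y) (h t) x = 1 / 2 * omega g F X Y (h t) x := by
  simp [pair, secA, ha.inner_h_h hx]

omit hx in
theorem secA_sec (i : Fin p) (s : Fin q) : IsSec (orthDistrib g F) U (secA g F h (f i) (h s)) := by
  refine ⟨?_, fun y hy ↦ ha.secA_mem hy _ _⟩
  exact .smul (φ := fun _ ↦ (1 / 2 : ℝ)) contMDiffOn_const
    (.sum fun t _ ↦ .smul (ha.smoothFnOn_omega i s t) (ha.normal.sec t).smooth)

/-- The normal components of the bracket with a normal field. -/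
theorem pair_mlieBracket_normal (X : VField E M) {V : VField E M}
    (hV : IsSec (orthDistrib g F) U V) (s : Fin q) :
    pair g (mlieBracket 𝓘(ℝ, E) X V) (h s) x = dirDeriv X (pair g V (h s)) x
      + ∑ t, pair g V (h t) x * pair g (mlieBracket 𝓘(ℝ, E) X (h t)) (h s) x := by
  have hT := ha.normal.tensorial_expand
    (ha.dual_tensorial hx (X := X) (ha.normal.sec s).smooth) hV
  have hb : ∀ Z : VField E M, pair g (h s) (bott g F X Z) x
      = pair g (mlieBracket 𝓘(ℝ, E) X Z) (h s) x := fun Z ↦ by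
    rw [pair_symm]
    exact ha.inner_coproj_h hx _ s
  simp only [hb, ha.normal.dirDeriv_pair _ _ hx, zero_sub, smul_eq_mul, mul_neg,
    Finset.sum_neg_distrib, pair_symm g (h s) V] at hT
  linarith

/-- The function `Φ(ω)` in terms of the structure functions and of `ω`. -/
theorem Phi_eq :
    Phi g F f h x =
      (∑ s, ∑ t, (1 / 4 * ∑ i, omega g F (f i) (h s) (h t) x * omega g F (f i) (h s) (h t) x
        - 1 / 4 * ∑ i, omega g F (f i) (h t) (h t) x * omega g F (f i) (h s) (h s) x))
      + 2 * ∑ i, ∑ s,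
        (1 / 2 * ∑ j, structFn g f j i i x * omega g F (f j) (h s) (h s) x
        + 1 / 2 * ∑ t, structFn g (Sum.elim f h) (.inl i) (.inr s) (.inr t) x
            * omega g F (f i) (h s) (h t) x
        - (1 / 2 * dirDeriv (f i) (omega g F (f i) (h s) (h s)) x
          + 1 / 2 * ∑ t, omega g F (f i) (h s) (h t) x
            * structFn g (Sum.elim f h) (.inl i) (.inr t) (.inr s) x)
        - 1 / 4 * ∑ t, omega g F (f i) (h s) (h t) x * omega g F (f i) (h s) (h t) x) := by
  have hΓ := ha.full.christoffel hx
  have hhs : ∀ s, SmoothOn (h s) U := fun s ↦ (ha.normal.sec s).smooth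
  have hfs : ∀ i, SmoothOn (f i) U := fun i ↦ (ha.leaf.sec i).smooth
  -- The `F`-component of the symmetrized `∇_{h_s} h_t` is `-ω`: the brackets `[h_s, h_t]` cancel in
  -- the two Christoffel symbols. The first two terms of `Φ` thereby become quadratic in `ω`.
  have hhh : ∀ s t i, pair g (nabla g (h s) (h t)) (f i) x + pair g (nabla g (h t) (h s)) (f i) x
      = - omega g F (f i) (h s) (h t) x := by
    intro s t i
    have h1 := hΓ (.inr s) (.inr t) (.inl i)
    have h2 := hΓ (.inr t) (.inr s) (.inl i)
    rw [ha.omega_eq_structFn hx]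
    have h3 := structFn_skew g (Sum.elim f h) (.inr s) (.inr t) (.inl i) x
    have h4 := structFn_skew g (Sum.elim f h) (.inr s) (.inl i) (.inr t) x
    have h5 := structFn_skew g (Sum.elim f h) (.inr t) (.inl i) (.inr s) x
    simp only [structFn, Sum.elim_inl, Sum.elim_inr] at h1 h2 h3 h4 h5 ⊢
    linarith
  have hff : ∀ i j, pair g (nabla g (f i) (f i)) (f j) x = structFn g f j i i x := by
    intro i j
    have h1 := hΓ (.inl i) (.inl i) (.inl j)
    have h2 := structFn_self g f i j x
    have h3 := structFn_skew g f i j i x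
    simp only [structFn, Sum.elim_inl] at h1 h2 h3 ⊢
    linarith
  simp only [Phi]
  congr 1
  · refine Finset.sum_congr rfl fun s _ ↦ Finset.sum_congr rfl fun t _ ↦ ?_
    rw [ha.omega_tang hx ((ha.full.smoothOn_nabla (hhs s) (hhs t)).add
        (ha.full.smoothOn_nabla (hhs t) (hhs s))),
      ha.omega_tang hx (ha.full.smoothOn_nabla (hhs t) (hhs t))]
    simp only [pair_add_left, hhh]
    have h1 : ∀ i, pair g (nabla g (h t) (h t)) (f i) x
        = - (1 / 2) * omega g F (f i) (h t) (h t) x := fun i ↦ by linarith [hhh t t i]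
    simp only [h1, Finset.mul_sum]
    rw [← Finset.sum_add_distrib, ← Finset.sum_sub_distrib]
    exact Finset.sum_congr rfl fun i _ ↦ by ring
  · congr 1
    refine Finset.sum_congr rfl fun i _ ↦ Finset.sum_congr rfl fun s _ ↦ ?_
    -- The bracket of `f_i` with `A_{is}` is the only term that differentiates `ω`; its
    -- `h_s`-component gives `½ f_i(ω(f_i)(h_s, h_s))` and a quadratic sum.
    rw [ha.omega_tang hx (ha.full.smoothOn_nabla (hfs i) (hfs i)),
      ha.omega_right hx (f i) (h s) (ha.secA_mem hx _ _),
      ha.omega_right hx (f i) (h s) (V := perp g F (mlieBracket 𝓘(ℝ, E) (f i) (h s))) ?_,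
      ha.pair_mlieBracket_normal hx _ (ha.secA_sec i s),
      dirDeriv_congr ha.full.isOpen (fun y hy ↦ ha.pair_secA hy (f i) (h s) s) hx,
      dirDeriv_const_mul ha.full.isOpen hx _ (ha.smoothFnOn_omega i s s)]
    · simp only [hff, ha.pair_secA hx]
      have h1 : ∀ t, pair g (perp g F (mlieBracket 𝓘(ℝ, E) (f i) (h s))) (h t) x
          = structFn g (Sum.elim f h) (.inl i) (.inr s) (.inr t) x :=
        fun t ↦ ha.inner_coproj_h hx _ t
      simp only [h1, mul_assoc, ← Finset.mul_sum]
      simp only [structFn, Sum.elim_inl, Sum.elim_inr]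
      ring
    · exact coproj_mem_orthDistrib _

end IsAdapted

end Omega

/-! ### The scalar curvature in terms of structure functions -/

section Structure

/-- The Christoffel symbols determined by structure constants in an orthonormal frame. -/
noncomputable def chr {ι : Type*} (C : ι → ι → ι → ℝ) (a b c : ι) : ℝ :=
  (C a b c - C a c b - C b c a) / 2

/-- The contribution of three frame vectors to the quadratic part of the scalar curvature. -/
noncomputable def quadTerm {ι : Type*} (C : ι → ι → ι → ℝ) (a b c : ι) : ℝ :=
  chr C b b c * chr C a c a - chr C a b c * chr C b c a - C a b c * chr C c b a

/-- The part of the scalar curvature which is quadratic in the structure constants. -/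
noncomputable def quad {ι : Type*} [Fintype ι] (C : ι → ι → ι → ℝ) : ℝ :=
  ∑ a, ∑ b, ∑ c, quadTerm C a b c

theorem continuous_chr {ι : Type*} (a b c : ι) :
    Continuous fun C : ι → ι → ι → ℝ ↦ chr C a b c := by
  unfold chr
  fun_prop

theorem continuous_quad {ι : Type*} [Fintype ι] : Continuous (quad (ι := ι)) := by
  unfold quad quadTerm chr
  fun_prop

variable {p q : ℕ}

/-- The limiting structure constants of the adiabatic metrics. -/
noncomputable def limitStruct (A : Fin p → Fin p → Fin p → ℝ) (K : Fin p → Fin q → Fin q → ℝ) :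
    Fin p ⊕ Fin q → Fin p ⊕ Fin q → Fin p ⊕ Fin q → ℝ
  | .inl i, .inl j, .inl k => A i j k
  | .inl i, .inr s, .inr t => K i s t
  | .inr s, .inl i, .inr t => - K i s t
  | _, _, _ => 0

theorem sum_transpose_mul_symm (K : Fin q → Fin q → ℝ) :
    ∑ s, ∑ t, K t s * (K s t + K t s) = ∑ s, ∑ t, K s t * (K s t + K t s) := by
  rw [Finset.sum_comm]
  exact Finset.sum_congr rfl fun s _ ↦ Finset.sum_congr rfl fun t _ ↦ by ring

/-- The triple sum is split by the types (leaf `l` or normal `r`) of its three indices. Block `lll`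
is `quad A`, while `llr` and `rrr` vanish. Blocks `lrl` and `rll` each give minus the `A`-`K` cross
sum. Blocks `lrr`, `rlr`, `rrl` give `-¼`, `-¼`, `+¼` of the square of `K + Kᵀ`, and `rrl` also the
squared traces. -/
theorem quad_limitStruct {A : Fin p → Fin p → Fin p → ℝ} (hA : ∀ i j k, A i j k = - A j i k)
    (K : Fin p → Fin q → Fin q → ℝ) :
    quad (limitStruct A K) = quad A - 2 * (∑ i, ∑ s, ∑ j, A j i i * K j s s)
      - (1 / 4) * (∑ i, ∑ s, ∑ t, (K i s t + K i t s) * (K i s t + K i t s))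
      - ∑ i, ∑ s, ∑ t, K i t t * K i s s := by
  have hA0 : ∀ i k, A i i k = 0 := fun i k ↦ by linarith [hA i i k]
  have c_lll : ∀ i j k, chr (limitStruct A K) (.inl i) (.inl j) (.inl k) = chr A i j k :=
    fun i j k ↦ rfl
  have c_llr : ∀ i j s, chr (limitStruct A K) (.inl i) (.inl j) (.inr s) = 0 := by
    intro i j s; simp [chr, limitStruct]
  have c_lrl : ∀ i s j, chr (limitStruct A K) (.inl i) (.inr s) (.inl j) = 0 := by
    intro i j s; simp [chr, limitStruct]
  have c_rll : ∀ s i j, chr (limitStruct A K) (.inr s) (.inl i) (.inl j) = 0 := by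
    intro i j s; simp [chr, limitStruct]
  have c_lrr : ∀ i s t, chr (limitStruct A K) (.inl i) (.inr s) (.inr t)
      = (K i s t - K i t s) / 2 := by
    intro i s t; simp [chr, limitStruct]
  have c_rlr : ∀ s i t, chr (limitStruct A K) (.inr s) (.inl i) (.inr t)
      = -(K i s t + K i t s) / 2 := by
    intro s i t; simp only [chr, limitStruct]; ring
  have c_rrl : ∀ s t i, chr (limitStruct A K) (.inr s) (.inr t) (.inl i)
      = (K i s t + K i t s) / 2 := by
    intro s t i; simp only [chr, limitStruct]; ring
  have c_rrr : ∀ s t u, chr (limitStruct A K) (.inr s) (.inr t) (.inr u) = 0 := by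
    intro s t u; simp [chr, limitStruct]
  have hA1 : ∀ i k, chr A i k i = - A k i i := by
    intro i k; simp only [chr]; rw [hA0, hA i k i]; ring
  have hA2 : ∀ j k, chr A j j k = A k j j := by
    intro j k; simp only [chr]; rw [hA0, hA j k j]; ring
  have hX : ∑ s, ∑ i, ∑ j, A j i i * K j s s = ∑ i, ∑ s, ∑ j, A j i i * K j s s :=
    Finset.sum_comm
  -- An antisymmetric matrix is orthogonal to a symmetric one, so only the symmetric part of `K i`
  -- survives here and in `hrow'`.
  have hrow : ∀ i, ∑ s, ∑ t, (K i s t - K i t s) * (K i s t + K i t s) = 0 := fun i ↦ by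
    simp only [sub_mul, Finset.sum_sub_distrib, sum_transpose_mul_symm (K i), sub_self]
  have hrow' : ∀ i, ∑ s, ∑ t, K i s t * (K i s t + K i t s)
      = (1 / 2) * ∑ s, ∑ t, (K i s t + K i t s) * (K i s t + K i t s) := fun i ↦ by
    simp only [add_mul (K i _ _) (K i _ _), Finset.sum_add_distrib, sum_transpose_mul_symm (K i)]
    ring
  have hlrl : ∑ i, ∑ s, ∑ k, (K k s s * - A k i i) = - ∑ i, ∑ s, ∑ j, A j i i * K j s s := by
    simp only [← Finset.sum_neg_distrib]
    refine Finset.sum_congr rfl fun i _ ↦ Finset.sum_congr rfl fun s _ ↦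
      Finset.sum_congr rfl fun k _ ↦ by ring
  have hrll : ∑ s, ∑ i, ∑ k, (A k i i * - K k s s) = - ∑ i, ∑ s, ∑ j, A j i i * K j s s := by
    rw [← hX]
    simp only [mul_neg, Finset.sum_neg_distrib]
  have hlrr : ∑ i, ∑ s, ∑ t, (-((K i s t - K i t s) / 2 * ((K i s t + K i t s) / 2))
      - K i s t * ((K i s t + K i t s) / 2))
      = - (1 / 4) * ∑ i, ∑ s, ∑ t, (K i s t + K i t s) * (K i s t + K i t s) := by
    rw [Finset.mul_sum]
    refine Finset.sum_congr rfl fun i _ ↦ ?_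
    have h1 : ∀ s t, -((K i s t - K i t s) / 2 * ((K i s t + K i t s) / 2))
        - K i s t * ((K i s t + K i t s) / 2)
        = - (1 / 4) * ((K i s t - K i t s) * (K i s t + K i t s))
          - (1 / 2) * (K i s t * (K i s t + K i t s)) := fun s t ↦ by ring
    simp only [h1, Finset.sum_sub_distrib, ← Finset.mul_sum, hrow, hrow']
    ring
  have hrlr : ∑ s, ∑ i, ∑ t, (-(-(K i s t + K i t s) / 2 * ((K i t s - K i s t) / 2))
      - -K i s t * (-(K i t s + K i s t) / 2))
      = - (1 / 4) * ∑ i, ∑ s, ∑ t, (K i s t + K i t s) * (K i s t + K i t s) := by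
    rw [← hlrr, Finset.sum_comm]
    refine Finset.sum_congr rfl fun i _ ↦ Finset.sum_congr rfl fun s _ ↦
      Finset.sum_congr rfl fun t _ ↦ by ring
  have hrrl : ∑ s, ∑ t, ∑ k, (K k t t * -K k s s
      - (K k s t + K k t s) / 2 * (-(K k t s + K k s t) / 2))
      = (1 / 4) * (∑ i, ∑ s, ∑ t, (K i s t + K i t s) * (K i s t + K i t s))
        - ∑ i, ∑ s, ∑ t, K i t t * K i s s := by
    rw [Finset.mul_sum, ← Finset.sum_sub_distrib]
    simp_rw [Finset.mul_sum, ← Finset.sum_sub_distrib]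
    simp_rw [Finset.sum_comm (s := (Finset.univ : Finset (Fin q)))
      (t := (Finset.univ : Finset (Fin p)))]
    refine Finset.sum_congr rfl fun i _ ↦ Finset.sum_congr rfl fun s _ ↦
      Finset.sum_congr rfl fun t _ ↦ by ring
  have hblocks : quad (limitStruct A K) = quad A
      + (∑ i, ∑ s, ∑ k, (K k s s * - A k i i)
        + ∑ i, ∑ s, ∑ t, (-((K i s t - K i t s) / 2 * ((K i s t + K i t s) / 2))
          - K i s t * ((K i s t + K i t s) / 2)))
      + (∑ s, ∑ i, ∑ k, (A k i i * - K k s s)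
        + ∑ s, ∑ i, ∑ t, (-(-(K i s t + K i t s) / 2 * ((K i t s - K i s t) / 2))
          - -K i s t * (-(K i t s + K i s t) / 2)))
      + ∑ s, ∑ t, ∑ k, (K k t t * -K k s s
        - (K k s t + K k t s) / 2 * (-(K k t s + K k s t) / 2)) := by
    have t_lll : ∀ i j k, quadTerm (limitStruct A K) (.inl i) (.inl j) (.inl k)
        = quadTerm A i j k := fun i j k ↦ rfl
    have t_llr : ∀ i j s, quadTerm (limitStruct A K) (.inl i) (.inl j) (.inr s) = 0 := by
      intro i j s
      simp [quadTerm, c_llr, c_lrl, limitStruct]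
    have t_lrl : ∀ i s k, quadTerm (limitStruct A K) (.inl i) (.inr s) (.inl k)
        = K k s s * - A k i i := by
      intro i s k
      simp only [quadTerm, c_rrl, c_lll, c_lrl, c_rll, limitStruct, hA1]
      ring
    have t_lrr : ∀ i s t, quadTerm (limitStruct A K) (.inl i) (.inr s) (.inr t)
        = -((K i s t - K i t s) / 2 * ((K i s t + K i t s) / 2))
          - K i s t * ((K i s t + K i t s) / 2) := by
      intro i s t
      simp only [quadTerm, c_rrr, c_lrr, c_rrl, limitStruct]
      ring
    have t_rll : ∀ s i k, quadTerm (limitStruct A K) (.inr s) (.inl i) (.inl k)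
        = A k i i * - K k s s := by
      intro s i k
      simp only [quadTerm, c_lll, c_rlr, c_rll, c_llr, limitStruct, hA2]
      ring
    have t_rlr : ∀ s i t, quadTerm (limitStruct A K) (.inr s) (.inl i) (.inr t)
        = -(-(K i s t + K i t s) / 2 * ((K i t s - K i s t) / 2))
          - -K i s t * (-(K i t s + K i s t) / 2) := by
      intro s i t
      simp only [quadTerm, c_llr, c_rlr, c_lrr, limitStruct]
      ring
    have t_rrl : ∀ s t k, quadTerm (limitStruct A K) (.inr s) (.inr t) (.inl k)
        = K k t t * -K k s s - (K k s t + K k t s) / 2 * (-(K k t s + K k s t) / 2) := by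
      intro s t k
      simp only [quadTerm, c_rrl, c_rlr, limitStruct]
      ring
    have t_rrr : ∀ s t u, quadTerm (limitStruct A K) (.inr s) (.inr t) (.inr u) = 0 := by
      intro s t u
      simp [quadTerm, c_rrr, limitStruct]
    rw [quad]
    simp only [Fintype.sum_sum_type, t_lll, t_llr, t_lrl, t_lrr, t_rll, t_rlr, t_rrl, t_rrr,
      Finset.sum_const_zero, add_zero]
    rw [Finset.sum_add_distrib, Finset.sum_add_distrib]
    simp only [Finset.sum_add_distrib (f := fun _ ↦ ∑ _, _)]
    rw [quad]
    ring
  rw [hblocks, hlrl, hrll, hlrr, hrlr, hrrl]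
  ring

/-- By symmetry of `om`, its pairings with `K` and with the transpose of `K` cancel. The squares of
`om` have total coefficient `¼ - ½ = -¼`, and the trace of `om i` is `-2` times that of `K i`. The
parameter `d` stands for the derivatives `f_i(ω(f_i)(h_s, h_s))`. -/
theorem phi_algebra (A : Fin p → Fin p → Fin p → ℝ) (K : Fin p → Fin q → Fin q → ℝ)
    (d : Fin p → Fin q → ℝ) {om : Fin p → Fin q → Fin q → ℝ}
    (hom : ∀ i s t, om i s t = - (K i s t + K i t s)) :
    (∑ s, ∑ t, (1 / 4 * ∑ i, om i s t * om i s t - 1 / 4 * ∑ i, om i t t * om i s s))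
      + 2 * ∑ i, ∑ s, (1 / 2 * ∑ j, A j i i * om j s s + 1 / 2 * ∑ t, K i s t * om i s t
        - (1 / 2 * d i s + 1 / 2 * ∑ t, om i s t * K i t s)
        - 1 / 4 * ∑ t, om i s t * om i s t)
      = - (∑ i, ∑ s, d i s) - 2 * (∑ i, ∑ s, ∑ j, A j i i * K j s s)
        - (1 / 4) * (∑ i, ∑ s, ∑ t, (K i s t + K i t s) * (K i s t + K i t s))
        - ∑ i, ∑ s, ∑ t, K i t t * K i s s := by
  have hcomm : ∀ φ : Fin p → Fin q → Fin q → ℝ,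
      ∑ s, ∑ t, ∑ i, φ i s t = ∑ i, ∑ s, ∑ t, φ i s t := fun φ ↦ by
    simp_rw [Finset.sum_comm (s := (Finset.univ : Finset (Fin q)))
      (t := (Finset.univ : Finset (Fin p)))]
  have h1 : ∑ i, ∑ s, ∑ j, A j i i * om j s s = -2 * ∑ i, ∑ s, ∑ j, A j i i * K j s s := by
    simp only [Finset.mul_sum, hom]
    refine Finset.sum_congr rfl fun i _ ↦ Finset.sum_congr rfl fun s _ ↦
      Finset.sum_congr rfl fun k _ ↦ by ring
  have h2 : ∑ i, ∑ s, ∑ t, om i s t * K i t s = ∑ i, ∑ s, ∑ t, K i s t * om i s t := by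
    refine Finset.sum_congr rfl fun i _ ↦ ?_
    rw [Finset.sum_comm]
    refine Finset.sum_congr rfl fun s _ ↦ Finset.sum_congr rfl fun t _ ↦ ?_
    rw [hom, hom]
    ring
  have h3 : ∑ i, ∑ s, ∑ t, om i s t * om i s t
      = ∑ i, ∑ s, ∑ t, (K i s t + K i t s) * (K i s t + K i t s) := by
    simp only [hom, neg_mul_neg]
  have h4 : ∑ i, ∑ s, ∑ t, om i t t * om i s s = 4 * ∑ i, ∑ s, ∑ t, K i t t * K i s s := by
    simp only [Finset.mul_sum, hom]
    refine Finset.sum_congr rfl fun i _ ↦ Finset.sum_congr rfl fun s _ ↦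
      Finset.sum_congr rfl fun k _ ↦ by ring
  simp only [Finset.sum_add_distrib, Finset.sum_sub_distrib, ← Finset.mul_sum, hcomm]
  rw [h1, h2, h3, h4]
  ring

end Structure

/-! ### Curvature through structure functions, and the adiabatic limit -/

section Curvature

theorem SmoothMetric.smoothFnOn_pair {E : Type*} [NormedAddCommGroup E] [NormedSpace ℝ E]
    {M : Type*} [TopologicalSpace M] [ChartedSpace E M] [IsManifold 𝓘(ℝ, E) ∞ M]
    (g : SmoothMetric E M) {O : Set M} {X Y : VField E M}
    (hX : SmoothOn X O) (hY : SmoothOn Y O) :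
    SmoothFnOn E (pair g.toRiemannianMetric X Y) O := by
  let _ : RiemannianBundle (fun x : M ↦ TangentSpace 𝓘(ℝ, E) x) := ⟨g.toRiemannianMetric⟩
  exact ContMDiffOn.inner_bundle (IB := 𝓘(ℝ, E)) (F := E) (E := TangentSpace 𝓘(ℝ, E))
    (b := fun x : M ↦ x) hX hY

theorem tendsto_sqrt_comap :
    Tendsto (fun ε : Set.Ioi (0 : ℝ) ↦ √(ε : ℝ)) (comap Subtype.val (𝓝 (0 : ℝ))) (𝓝 0) := by
  have h : Tendsto (fun ε : Set.Ioi (0 : ℝ) ↦ (ε : ℝ)) (comap Subtype.val (𝓝 (0 : ℝ))) (𝓝 0) :=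
    tendsto_comap
  simpa using h.sqrt

variable {E : Type*} [NormedAddCommGroup E] [NormedSpace ℝ E] [FiniteDimensional ℝ E]
  {M : Type*} [TopologicalSpace M] [ChartedSpace E M] [IsManifold 𝓘(ℝ, E) ∞ M]

/-- Both derivative terms of the frame formula reduce to the same trace: the Christoffel symbols
`bba` and `aba` are `-C b a b` and `C a b a`. Exchanging `a` and `b` in the second gives the factor
`-2`. The distribution is kept general to cover both the tangent bundle and `F`. -/
theorem IsOrthoFrame.sum_curvature_eq_structFn {G : TMetric E M} {W : Distrib E M} {U : Set M}
    {ι : Type*} [Fintype ι] [DecidableEq ι] {e : ι → VField E M}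
    {D : VField E M → VField E M → VField E M} (he : IsOrthoFrame G W U e) (hD : IsConn W U D)
    (hΓ : ∀ y ∈ U, ∀ a b c, pair G (D (e a) (e b)) (e c) y
      = chr (fun a b c ↦ structFn G e a b c y) a b c) {x : M} (hx : x ∈ U) :
    ∑ a, ∑ b, pair G (curvature D (e a) (e b) (e b)) (e a) x
      = -2 * (∑ a, ∑ b, dirDeriv (e a) (structFn G e b a b) x)
        + quad (fun a b c ↦ structFn G e a b c x) := by
  have h1 : ∀ a b, dirDeriv (e a) (pair G (D (e b) (e b)) (e a)) x
      = - dirDeriv (e a) (structFn G e b a b) x := fun a b ↦ by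
    rw [dirDeriv_congr he.isOpen (ψ := fun y ↦ -1 * structFn G e b a b y) (fun y hy ↦ ?_) hx,
      dirDeriv_const_mul he.isOpen hx _ (he.smoothFnOn_structFn b a b)]
    · ring
    · rw [hΓ y hy, chr, structFn_self]
      ring
  have h2 : ∀ a b, dirDeriv (e b) (pair G (D (e a) (e b)) (e a)) x
      = dirDeriv (e b) (structFn G e a b a) x := fun a b ↦ by
    refine dirDeriv_congr he.isOpen (fun y hy ↦ ?_) hx
    rw [hΓ y hy, chr, structFn_self, structFn_skew G e b a a]
    ring
  simp only [he.curvature_frame hD hx, h1, h2, hΓ x hx, quad, quadTerm, Finset.sum_add_distrib,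
    Finset.sum_sub_distrib, Finset.sum_neg_distrib]
  rw [Finset.sum_comm (f := fun a b ↦ dirDeriv (e b) (structFn G e a b a) x)]
  simp only [structFn]
  ring

variable {g : TMetric E M} {F : Distrib E M}
  {p q : ℕ} {U : Set M} {f : Fin p → VField E M} {h : Fin q → VField E M}

namespace IsAdapted

variable (ha : IsAdapted g F U f h) {x : M} (hx : x ∈ U)
include ha hx

theorem leafScalarCurvature_eq_structFn :
    leafScalarCurvature g F x = -2 * (∑ i, ∑ j, dirDeriv (f i) (structFn g f j i j) x)
      + quad (fun i j k ↦ structFn g f i j k x) := by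
  rw [ha.leafScalarCurvature_eq hx,
    ha.leaf.sum_curvature_eq_structFn ha.isConn_nablaF (fun y hy i j k ↦ ?_) hx]
  have h1 : pair g (nablaF g F (f i) (f j)) (f k) y = pair g (nabla g (f i) (f j)) (f k) y := by
    rw [pair, ha.nablaF_eq _ (ha.leaf.sec j) y hy]
    exact inner_proj_of_mem g F y _ ((ha.leaf.sec k).mem y hy)
  rw [h1]
  exact ha.full.christoffel hy (.inl i) (.inl j) (.inl k)

theorem structFn_adiabatic (ε : Set.Ioi (0 : ℝ)) (a b c : Fin p ⊕ Fin q) :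
    structFn (adiabatic g F ε) (scaledFrame f h √ε) a b c x
      = frameScale p q √ε a * frameScale p q √ε b * (frameScale p q √ε c)⁻¹
        * structFn g (Sum.elim f h) a b c x := by
  have ho := ha.full.isOpen
  simp only [structFn, pair]
  rw [ha.adiabatic_inner_scaledFrame hx]
  have h1 : mlieBracket 𝓘(ℝ, E) (scaledFrame f h √ε a) (scaledFrame f h √ε b) x
      = (frameScale p q √ε a * frameScale p q √ε b)
        • mlieBracket 𝓘(ℝ, E) (Sum.elim f h a) (Sum.elim f h b) x := by
    unfold scaledFrame
    rw [mlieBracket_fun_smul_left (φ := fun _ ↦ frameScale p q √ε a) ho hx contMDiffOn_const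
        (ha.full.sec a).smooth,
      mlieBracket_fun_smul_right (φ := fun _ ↦ frameScale p q √ε b) ho hx contMDiffOn_const
        (ha.full.sec b).smooth]
    simp only [dirDeriv_const]
    module
  rw [h1]
  simp only [map_smul, FunLike.coe_smul, Pi.smul_apply, smul_eq_mul]
  ring

/-- In the structure function `b a b` the scale of `e_b` cancels and that of `e_a` remains;
differentiating along the scaled `e_a` squares it. So derivatives along the leaves are unchanged and
normal ones are multiplied by `ε`. -/
theorem scalarCurvature_adiabatic (ε : Set.Ioi (0 : ℝ)) :
    scalarCurvature (adiabatic g F ε) x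
      = -2 * (∑ a, ∑ b, frameScale p q √ε a * frameScale p q √ε a
          * dirDeriv (Sum.elim f h a) (structFn g (Sum.elim f h) b a b) x)
        + quad (fun a b c ↦ structFn (adiabatic g F ε) (scaledFrame f h √ε) a b c x) := by
  have he := ha.adiabatic_frame ε
  rw [he.scalarCurvature_eq (by simpa using ha.finrank_full) hx,
    he.sum_curvature_eq_structFn he.isConn_nabla (fun y hy a b c ↦ he.christoffel hy a b c) hx]
  congr 2
  refine Finset.sum_congr rfl fun a _ ↦ Finset.sum_congr rfl fun b _ ↦ ?_
  have hb := frameScale_ne_zero (p := p) (q := q) (Real.sqrt_pos.2 ε.2).ne' b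
  rw [dirDeriv_congr ha.full.isOpen
      (ψ := fun y ↦ frameScale p q √ε a * structFn g (Sum.elim f h) b a b y) (fun y hy ↦ ?_) hx,
    dirDeriv_const_mul ha.full.isOpen hx _ (ha.full.smoothFnOn_structFn b a b)]
  · unfold scaledFrame
    rw [dirDeriv_smul_left (fun _ ↦ frameScale p q √ε a)]
    ring
  · rw [ha.structFn_adiabatic hy]
    field_simp

/-- By integrability. These are the only structure functions whose scaling factor, `1/√ε`, is
unbounded. -/
theorem structFn_leaf_normal (i j : Fin p) (s : Fin q) :
    structFn g (Sum.elim f h) (.inl i) (.inl j) (.inr s) x = 0 :=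
  ha.inner_mem_h hx ((ha.isConn_nablaF.bracket _ _ (ha.leaf.sec i) (ha.leaf.sec j)).mem x hx) s

/-- Among the eight index types, those with as many normal indices in the bracket as in the last
slot have factor `1`. Those with one or two more have factor `√ε` or `ε`, and the remaining one
vanishes. -/
theorem tendsto_structFn_adiabatic (a b c : Fin p ⊕ Fin q) :
    Tendsto (fun ε : Set.Ioi (0 : ℝ) ↦ structFn (adiabatic g F ε) (scaledFrame f h √ε) a b c x)
      (comap Subtype.val (𝓝 (0 : ℝ)))
      (𝓝 (limitStruct (fun i j k ↦ structFn g f i j k x)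
        (fun i s t ↦ structFn g (Sum.elim f h) (.inl i) (.inr s) (.inr t) x) a b c)) := by
  have hr := tendsto_sqrt_comap
  have hpos : ∀ ε : Set.Ioi (0 : ℝ), √(ε : ℝ) ≠ 0 := fun ε ↦ (Real.sqrt_pos.2 ε.2).ne'
  simp only [ha.structFn_adiabatic hx]
  have hm : ∀ c : ℝ, Tendsto (fun ε : Set.Ioi (0 : ℝ) ↦ √(ε : ℝ) * c)
      (comap Subtype.val (𝓝 (0 : ℝ))) (𝓝 0) := fun c ↦ by simpa using hr.mul_const c
  have hm2 : ∀ c : ℝ, Tendsto (fun ε : Set.Ioi (0 : ℝ) ↦ √(ε : ℝ) * √(ε : ℝ) * c)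
      (comap Subtype.val (𝓝 (0 : ℝ))) (𝓝 0) := fun c ↦ by simpa using (hr.mul hr).mul_const c
  rcases a with i | s <;> rcases b with j | t <;> rcases c with k | u
  · simpa [frameScale, limitStruct] using! tendsto_const_nhds
  · simpa [frameScale, limitStruct, ha.structFn_leaf_normal hx] using! tendsto_const_nhds
  · simpa [frameScale, limitStruct] using hm _
  · simpa [frameScale, limitStruct, hpos] using! tendsto_const_nhds
  · simpa [frameScale, limitStruct] using hm _
  · simp only [frameScale, limitStruct, Sum.elim_inl, Sum.elim_inr, mul_one,
      mul_inv_cancel₀ (hpos _), one_mul]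
    rw [structFn_skew]
    exact tendsto_const_nhds
  · simpa [frameScale, limitStruct] using hm2 _
  · simpa [frameScale, limitStruct, hpos] using hm _

theorem tendsto_scalarCurvature_adiabatic :
    Tendsto (fun ε : Set.Ioi (0 : ℝ) ↦ scalarCurvature (adiabatic g F ε) x)
      (comap Subtype.val (𝓝 (0 : ℝ))) (𝓝 (leafScalarCurvature g F x + Phi g F f h x)) := by
  have hscale : ∀ a, Tendsto (fun ε : Set.Ioi (0 : ℝ) ↦ frameScale p q √(ε : ℝ) a)
      (comap Subtype.val (𝓝 (0 : ℝ))) (𝓝 (frameScale p q 0 a)) := by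
    rintro (i | s)
    · exact tendsto_const_nhds
    · exact tendsto_sqrt_comap
  have hlim : Tendsto (fun ε : Set.Ioi (0 : ℝ) ↦ scalarCurvature (adiabatic g F ε) x)
      (comap Subtype.val (𝓝 (0 : ℝ)))
      (𝓝 (-2 * (∑ a, ∑ b, frameScale p q 0 a * frameScale p q 0 a
          * dirDeriv (Sum.elim f h a) (structFn g (Sum.elim f h) b a b) x)
        + quad (limitStruct (fun i j k ↦ structFn g f i j k x)
          (fun i s t ↦ structFn g (Sum.elim f h) (.inl i) (.inr s) (.inr t) x)))) := by
    simp only [ha.scalarCurvature_adiabatic hx]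
    refine Tendsto.add (Tendsto.const_mul _ (tendsto_finsetSum _ fun a _ ↦
      tendsto_finsetSum _ fun b _ ↦ ((hscale a).mul (hscale a)).mul_const _)) ?_
    refine (continuous_quad.tendsto _).comp ?_
    simp only [tendsto_pi_nhds]
    exact ha.tendsto_structFn_adiabatic hx
  convert hlim using 2
  -- On the diagonal, `ω(f_i)(h_s, h_s) = -2⟨[f_i, h_s], h_s⟩`. The derivatives that survive in
  -- normal traces are thus those occurring in `Φ`.
  have hd : ∀ i s, dirDeriv (f i) (structFn g (Sum.elim f h) (.inr s) (.inl i) (.inr s)) x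
      = 1 / 2 * dirDeriv (f i) (omega g F (f i) (h s) (h s)) x := fun i s ↦ by
    rw [← dirDeriv_const_mul ha.full.isOpen hx _ (ha.smoothFnOn_omega i s s)]
    refine dirDeriv_congr ha.full.isOpen (fun y hy ↦ ?_) hx
    rw [ha.omega_eq_structFn hy, structFn_skew]
    ring
  rw [ha.leafScalarCurvature_eq_structFn hx, ha.Phi_eq hx,
    phi_algebra (fun i j k ↦ structFn g f i j k x)
      (fun i s t ↦ structFn g (Sum.elim f h) (.inl i) (.inr s) (.inr t) x)
      (fun i s ↦ dirDeriv (f i) (omega g F (f i) (h s) (h s)) x)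
      (fun i s t ↦ ha.omega_eq_structFn hx i s t),
    quad_limitStruct (fun i j k ↦ structFn_skew g f i j k x)]
  simp only [Fintype.sum_sum_type, frameScale, Sum.elim_inl, Sum.elim_inr, mul_zero, zero_mul,
    one_mul, Finset.sum_const_zero, add_zero, Finset.sum_add_distrib, hd, ← Finset.mul_sum]
  have hleaf : ∀ i j, structFn g (Sum.elim f h) (.inl j) (.inl i) (.inl j) = structFn g f j i j :=
    fun _ _ ↦ rfl
  simp only [hleaf]
  ring

theorem tendsto_perp_nabla_adiabatic (i : Fin p) (s : Fin q) :
    Tendsto (fun ε : Set.Ioi (0 : ℝ) ↦ perp g F (nabla (adiabatic g F ε) (h s) (f i)) x)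
      (comap Subtype.val (𝓝 (0 : ℝ))) (𝓝 (secA g F h (f i) (h s) x)) := by
  -- The factor `√ε` from `√ε h_s` and the factor `1/√ε` from pairing with `√ε h_t` in `g^ε` cancel.
  -- The component is therefore a Christoffel symbol of the rescaled frame, hence continuous in its
  -- structure functions.
  have hcomp : ∀ (ε : Set.Ioi (0 : ℝ)) (t : Fin q),
      g.inner x (nabla (adiabatic g F ε) (h s) (f i) x) (h t x)
        = chr (fun a b c ↦ structFn (adiabatic g F ε) (scaledFrame f h √ε) a b c x)
          (.inr s) (.inl i) (.inr t) := by
    intro ε t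
    have he := ha.adiabatic_frame ε
    have hr : √(ε : ℝ) ≠ 0 := (Real.sqrt_pos.2 ε.2).ne'
    have h1 := he.christoffel hx (.inr s) (.inl i) (.inr t)
    have h2 : nabla (adiabatic g F ε) (scaledFrame f h √ε (.inr s)) (scaledFrame f h √ε (.inl i)) x
        = √(ε : ℝ) • nabla (adiabatic g F ε) (h s) (f i) x := by
      refine (nabla_congr (adiabatic g F ε) ha.full.isOpen (X' := fun y ↦ √(ε : ℝ) • h s y)
        (Y' := f i) (fun _ _ ↦ rfl) (fun y _ ↦ one_smul ℝ (f i y)) hx).trans ?_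
      exact he.isConn_nabla.smul_left (fun _ ↦ √(ε : ℝ)) _ _ contMDiffOn_const
        (.top (ha.normal.sec s).smooth) (.top (ha.leaf.sec i).smooth) x hx
    rw [pair, h2, ha.adiabatic_inner_scaledFrame hx] at h1
    refine Eq.trans ?_ h1
    simp only [frameScale, Sum.elim_inr, map_smul, FunLike.coe_smul, Pi.smul_apply, smul_eq_mul]
    field_simp
  have hA : secA g F h (f i) (h s) x = ∑ t, (1 / 2 * omega g F (f i) (h s) (h t) x) • h t x := by
    simp only [secA, Finset.smul_sum, smul_smul]
  simp only [perp, ha.coproj_eq hx, hcomp, hA]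
  refine tendsto_finsetSum _ fun t _ ↦ Tendsto.smul_const ?_ (h t x)
  have hC : Tendsto (fun ε : Set.Ioi (0 : ℝ) ↦ fun a b c ↦
      structFn (adiabatic g F ε) (scaledFrame f h √ε) a b c x) (comap Subtype.val (𝓝 (0 : ℝ)))
      (𝓝 (limitStruct (fun i j k ↦ structFn g f i j k x)
        (fun i s t ↦ structFn g (Sum.elim f h) (.inl i) (.inr s) (.inr t) x))) := by
    simp only [tendsto_pi_nhds]
    exact ha.tendsto_structFn_adiabatic hx
  convert! ((continuous_chr (.inr s) (.inl i) (.inr t)).tendsto _).comp hC using 2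
  rw [ha.omega_eq_structFn hx]
  simp only [chr, limitStruct]
  ring

end IsAdapted

end Curvature

end Foliation

theorem mainTheorem5
    {E : Type*} [NormedAddCommGroup E] [NormedSpace ℝ E] [FiniteDimensional ℝ E]
    {M : Type*} [TopologicalSpace M] [ChartedSpace E M] [IsManifold 𝓘(ℝ, E) ∞ M]
    {p q : ℕ} (hpq : p + q = Module.finrank ℝ E)
    (F : Foliation.Distrib E M) (hF : Foliation.IsSubbundle F p) (hint : Foliation.IsIntegrable F)
    (g : Foliation.SmoothMetric E M)
    (U : Set M) (hU : IsOpen U)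
    (f : Fin p → Foliation.VField E M) (h : Fin q → Foliation.VField E M)
    (hfh : Foliation.IsAdaptedFrame g.toRiemannianMetric F U f h) (x : M) (hx : x ∈ U) :
    (∀ i s, Tendsto
      (fun ε : Set.Ioi (0 : ℝ) ↦ Foliation.perp g.toRiemannianMetric F
        (Foliation.nabla (Foliation.adiabatic g.toRiemannianMetric F ε) (h s) (f i)) x)
      (comap Subtype.val (𝓝 (0 : ℝ))) (𝓝 (Foliation.secA g.toRiemannianMetric F h (f i) (h s) x))) ∧
    Tendsto
      (fun ε : Set.Ioi (0 : ℝ) ↦ Foliation.scalarCurvature (Foliation.adiabatic g.toRiemannianMetric F ε) x)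
      (comap Subtype.val (𝓝 (0 : ℝ)))
      (𝓝 (Foliation.leafScalarCurvature g.toRiemannianMetric F x + Foliation.Phi g.toRiemannianMetric F f h x)) := by
  have ha := hfh.isAdapted hpq hF hint hU fun O _ X Y hX hY ↦
    Foliation.SmoothMetric.smoothFnOn_pair g hX hY
  exact ⟨ha.tendsto_perp_nabla_adiabatic hx, ha.tendsto_scalarCurvature_adiabatic hx⟩
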